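/- Let $M$ be a smooth finite-dimensional manifold and let $g(\tau)$, $\tau\in[\tau_1,\tau_2]$, $0\le\tau_1<\tau_2$, be a smooth solution of the backwards Ricci flow $\partial_\tau g=2\,\mathrm{Ric}$ on $M$ which is complete on every time slice and has uniformly bounded curvature. All geometric quantities at time $\tau$ (inner product, Levi-Civita connection $\nabla$, curvature tensor $R(A,B)C=\nabla_A\nabla_BC-\nabla_B\nabla_AC-\nabla_{[A,B]}C$, Ricci tensor $\mathrm{Ric}$, scalar curvature $R$, its gradient $\nabla R$ and Hessian $\mathrm{Hess}\,R$) are those of $g(\tau)$; $\mathrm{Ric}(Y)$ and $(\nabla_U\mathrm{Ric})(Y)$ denote the vectors dual to $\mathrm{Ric}(Y,\cdot)$ and $(\nabla_U\mathrm{Ric})(Y,\cdot)$. In $\nabla_X\nabla_XU$ at time $\tau$ both covariant derivatives are taken with the connection of the metric $g(\tau)$ at that fixed time. Let $\gamma:[\tau_1,\tau_2]\to M$ be an $\mathcal L$-geodesic with velocity $X=\dot\gamma$, that is, a continuous curve, smooth at times $\tau>0$, with $$\nabla_XX-\tfrac12\nabla R+\tfrac1{2\tau}X+2\,\mathrm{Ric}(X)=0\qquad(\tau>0),$$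 and such that, if $\tau_1=0$, the limit $\lim_{\tau\to0}\sqrt\tau X(\tau)$ exists in $T_{\gamma(0)}M$. For vector fields $U,V$ along $\gamma$ put $$I(U,V)=\int_{\tau_1}^{\tau_2}\tau^{1/2}\big[(\mathrm{Hess}\,R)(U,V)+2\langle\nabla_XU,\nabla_XV\rangle+2\langle R(U,X)V,X\rangle-2(\nabla_U\mathrm{Ric})(V,X)-2(\nabla_V\mathrm{Ric})(U,X)+2(\nabla_X\mathrm{Ric})(U,V)\big]\,d\tau$$ and $$J(U)=\nabla_X\nabla_XU-R(X,U)X-\tfrac12\nabla_U(\nabla R)+2(\nabla_U\mathrm{Ric})(X)+2\,\mathrm{Ric}(\nabla_XU)+\tfrac1{2\tau}\nabla_XU .$$ Let $U$ be smooth and $V$ be continuous and piecewise smooth along $\gamma$ on $[\tau_1,\tau_2]$ (smooth as functions of $\sqrt\tau$, which for $\tau_1>0$ is the same as smooth in $\tau$, and with respect to a finite partition of $[\tau_1,\tau_2]$ into closed intervals). Then the integrand of $I(U,V)$ and the function $\tau^{1/2}\langle J(U),V\rangle$ are integrable on $[\tau_1,\tau_2]$, and $$I(U,V)=2\tau^{1/2}\langle\nabla_XU,V\rangle\Big|_{\tau_1}^{\tau_2}-2\int_{\tau_1}^{\tau_2}\tau^{1/2}\langle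 J(U),V\rangle\,d\tau ,$$ where, if $\tau_1=0$, the boundary value at $\tau_1$ is the limit $\lim_{\tau\to0^+}2\tau^{1/2}\langle\nabla_XU,V\rangle$, which exists. -/

import Mathlib

open Set Filter Topology MeasureTheory
open scoped Manifold ContDiff

noncomputable section

namespace LGeom

/-! ## Tensor calculus in a coordinate patch

`B : E → (E →L[ℝ] E →L[ℝ] ℝ)` is a Riemannian metric written in coordinates on the
finite-dimensional vector space `E`, `B y a b = g_y(a, b)`; points, and tangent vectors with
respect to the coordinate frame, are elements of `E`.  Constant vectors of `E` are the coordinate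
vector fields; they commute. -/

section Coordinates

variable {E : Type*} [NormedAddCommGroup E] [NormedSpace ℝ E]

/-- Raising an index: `sharp B y ℓ` is the vector `v` with `B y v w = ℓ w` for all `w`
(the metric, viewed as a map `E → E*`, is invertible). -/
def sharp (B : E → E →L[ℝ] E →L[ℝ] ℝ) (y : E) (ℓ : E →L[ℝ] ℝ) : E :=
  (B y).inverse ℓ

/-- Twice the Christoffel symbols with the last index lowered: the linear form
`c ↦ ∂_a g(b, c) + ∂_b g(a, c) - ∂_c g(a, b)`. -/
def koszulForm (B : E → E →L[ℝ] E →L[ℝ] ℝ) (y a b : E) : E →L[ℝ] ℝ :=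
  fderiv ℝ (fun z => B z b) y a + fderiv ℝ (fun z => B z a) y b - fderiv ℝ (fun z => B z a b) y

/-- The Christoffel symbols of the Levi-Civita connection: `Γ_y(a, b) = ∇_a b` for coordinate
vector fields `a, b`. -/
def christoffel (B : E → E →L[ℝ] E →L[ℝ] ℝ) (y a b : E) : E :=
  (1 / 2 : ℝ) • sharp B y (koszulForm B y a b)

/-- The Levi-Civita covariant derivative `∇_u Y` at `y` of the vector field `Y`. -/
def covDerivCoord (B : E → E →L[ℝ] E →L[ℝ] ℝ) (Y : E → E) (y u : E) : E :=
  fderiv ℝ Y y u + christoffel B y u (Y y)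

/-- The Riemann curvature tensor `R(a, b)c = ∇_a ∇_b c - ∇_b ∇_a c` (for coordinate vector
fields). -/
def riemannCoord (B : E → E →L[ℝ] E →L[ℝ] ℝ) (y a b c : E) : E :=
  (fderiv ℝ (fun z => christoffel B z b c) y a + christoffel B y a (christoffel B y b c))
    - (fderiv ℝ (fun z => christoffel B z a c) y b + christoffel B y b (christoffel B y a c))

/-- The gradient of a function. -/
def gradCoord (B : E → E →L[ℝ] E →L[ℝ] ℝ) (f : E → ℝ) (y : E) : E :=
  sharp B y (fderiv ℝ f y)

/-- The Hessian `(∇df)(a, b) = ∂_a ∂_b f - df(∇_a b)` of a function. -/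
def hessCoord (B : E → E →L[ℝ] E →L[ℝ] ℝ) (f : E → ℝ) (y a b : E) : ℝ :=
  fderiv ℝ (fun z => fderiv ℝ f z b) y a - fderiv ℝ f y (christoffel B y a b)

variable [FiniteDimensional ℝ E]

/-- The trace of a (linear) map `T : E → E`. -/
def traceOf (T : E → E) : ℝ :=
  ∑ i, (Module.finBasis ℝ E).coord i (T (Module.finBasis ℝ E i))

/-- A (linear) function `ℓ : E → ℝ`, bundled as a continuous linear form: the linear form that
agrees with `ℓ` on a basis. -/
def formOf (ℓ : E → ℝ) : E →L[ℝ] ℝ :=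
  LinearMap.toContinuousLinearMap ((Module.finBasis ℝ E).constr ℝ fun i => ℓ (Module.finBasis ℝ E i))

/-- The Ricci tensor `Ric(b, c) = tr (a ↦ R(a, b)c)`. -/
def ricciCoord (B : E → E →L[ℝ] E →L[ℝ] ℝ) (y b c : E) : ℝ :=
  traceOf fun a => riemannCoord B y a b c

/-- The Ricci tensor as an endomorphism, `⟨Ric(a), c⟩ = Ric(a, c)`. -/
def ricciSharpCoord (B : E → E →L[ℝ] E →L[ℝ] ℝ) (y a : E) : E :=
  sharp B y (formOf (ricciCoord B y a))

/-- The scalar curvature, the trace of the Ricci endomorphism. -/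
def scalarCoord (B : E → E →L[ℝ] E →L[ℝ] ℝ) (y : E) : ℝ :=
  traceOf (ricciSharpCoord B y)

/-- The covariant derivative of the Ricci tensor,
`(∇_u Ric)(a, c) = ∂_u (Ric(a, c)) - Ric(∇_u a, c) - Ric(a, ∇_u c)`. -/
def nablaRicciCoord (B : E → E →L[ℝ] E →L[ℝ] ℝ) (y u a c : E) : ℝ :=
  fderiv ℝ (fun z => ricciCoord B z a c) y u
    - ricciCoord B y (christoffel B y u a) c - ricciCoord B y a (christoffel B y u c)

/-- The vector `(∇_u Ric)(a)`, that is `⟨(∇_u Ric)(a), c⟩ = (∇_u Ric)(a, c)`. -/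
def nablaRicciSharpCoord (B : E → E →L[ℝ] E →L[ℝ] ℝ) (y u a : E) : E :=
  sharp B y (formOf (nablaRicciCoord B y u a))

end Coordinates

/-! ## Riemannian metrics on a manifold

Tensors at a point `p` are computed in the chart around `p`. -/

section Manifold

variable {E : Type*} [NormedAddCommGroup E] [NormedSpace ℝ E]
  {M : Type*} [TopologicalSpace M] [ChartedSpace E M] [IsManifold 𝓘(ℝ, E) ∞ M]

/-- The components of a tangent vector at `q` with respect to the chart around `p`
(that is, the differential at `q` of the chart around `p`). -/
def toCoord (p q : M) : TangentSpace 𝓘(ℝ, E) q →L[ℝ] E :=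
  (trivializationAt E (TangentSpace 𝓘(ℝ, E)) p).continuousLinearMapAt ℝ q

/-- The tangent vector at `q` with given components with respect to the chart around `p`
(the inverse of `toCoord p q`). -/
def ofCoord (p q : M) : E →L[ℝ] TangentSpace 𝓘(ℝ, E) q :=
  (trivializationAt E (TangentSpace 𝓘(ℝ, E)) p).symmL ℝ q

variable (E M) in
/-- Smooth Riemannian metrics on `M`. -/
abbrev Metric : Type _ :=
  Bundle.ContMDiffRiemannianMetric 𝓘(ℝ, E) ∞ E (fun x : M => TangentSpace 𝓘(ℝ, E) x)

/-- The metric `h` written in the chart around `p`, as a function on the target of the chart. -/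
def metricCoord (h : Metric E M) (p : M) (y : E) : E →L[ℝ] E →L[ℝ] ℝ :=
  (ContinuousLinearMap.precomp ℝ (ofCoord p ((extChartAt 𝓘(ℝ, E) p).symm y))) ∘L
    (h.inner ((extChartAt 𝓘(ℝ, E) p).symm y)) ∘L (ofCoord p ((extChartAt 𝓘(ℝ, E) p).symm y))

theorem metricCoord_apply (h : Metric E M) (p : M) (y a b : E) :
    metricCoord h p y a b = h.inner ((extChartAt 𝓘(ℝ, E) p).symm y)
      (ofCoord p ((extChartAt 𝓘(ℝ, E) p).symm y) a)
      (ofCoord p ((extChartAt 𝓘(ℝ, E) p).symm y) b) := rfl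

/-- The length of a tangent vector. -/
def len (h : Metric E M) {p : M} (a : TangentSpace 𝓘(ℝ, E) p) : ℝ :=
  Real.sqrt (h.inner p a a)

/-- The metric space `(M, d_h)`, with `d_h` the Riemannian distance (the infimum of the lengths of
`C^1` paths), is complete: every Cauchy sequence converges. -/
def IsCompleteMetric (h : Metric E M) : Prop :=
  letI : ∀ x : M, ENorm (TangentSpace 𝓘(ℝ, E) x) := fun _ => ⟨fun v => ENNReal.ofReal (len h v)⟩
  ∀ u : ℕ → M,
    (∀ ε : ENNReal, 0 < ε → ∃ N, ∀ m ≥ N, ∀ n ≥ N,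
      Manifold.riemannianEDist 𝓘(ℝ, E) (u m) (u n) < ε) →
    ∃ x, Tendsto (fun n => Manifold.riemannianEDist 𝓘(ℝ, E) (u n) x) atTop (𝓝 0)

/-- `R(a, b)c`, with `R(a, b)c = ∇_a ∇_b c - ∇_b ∇_a c - ∇_[a,b] c`. -/
def riemann (h : Metric E M) {p : M} (a b c : TangentSpace 𝓘(ℝ, E) p) : TangentSpace 𝓘(ℝ, E) p :=
  ofCoord p p (riemannCoord (metricCoord h p) (extChartAt 𝓘(ℝ, E) p p)
    (toCoord p p a) (toCoord p p b) (toCoord p p c))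

variable [FiniteDimensional ℝ E]

/-- `Ric(a, b)`. -/
def ricci (h : Metric E M) {p : M} (a b : TangentSpace 𝓘(ℝ, E) p) : ℝ :=
  ricciCoord (metricCoord h p) (extChartAt 𝓘(ℝ, E) p p) (toCoord p p a) (toCoord p p b)

/-- `Ric(a)`, the vector dual to `Ric(a, ·)`. -/
def ricciSharp (h : Metric E M) {p : M} (a : TangentSpace 𝓘(ℝ, E) p) : TangentSpace 𝓘(ℝ, E) p :=
  ofCoord p p (ricciSharpCoord (metricCoord h p) (extChartAt 𝓘(ℝ, E) p p) (toCoord p p a))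

/-- `(∇_u Ric)(a, b)`. -/
def nablaRicci (h : Metric E M) {p : M} (u a b : TangentSpace 𝓘(ℝ, E) p) : ℝ :=
  nablaRicciCoord (metricCoord h p) (extChartAt 𝓘(ℝ, E) p p)
    (toCoord p p u) (toCoord p p a) (toCoord p p b)

/-- `(∇_u Ric)(a)`, the vector dual to `(∇_u Ric)(a, ·)`. -/
def nablaRicciSharp (h : Metric E M) {p : M} (u a : TangentSpace 𝓘(ℝ, E) p) :
    TangentSpace 𝓘(ℝ, E) p :=
  ofCoord p p (nablaRicciSharpCoord (metricCoord h p) (extChartAt 𝓘(ℝ, E) p p)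
    (toCoord p p u) (toCoord p p a))

/-- The gradient `∇R` of the scalar curvature at `p`. -/
def gradScalar (h : Metric E M) (p : M) : TangentSpace 𝓘(ℝ, E) p :=
  ofCoord p p (gradCoord (metricCoord h p) (scalarCoord (metricCoord h p))
    (extChartAt 𝓘(ℝ, E) p p))

/-- The covariant derivative `∇_u (∇R)` of the gradient of the scalar curvature. -/
def covDerivGradScalar (h : Metric E M) {p : M} (u : TangentSpace 𝓘(ℝ, E) p) :
    TangentSpace 𝓘(ℝ, E) p :=
  ofCoord p p (covDerivCoord (metricCoord h p)
    (gradCoord (metricCoord h p) (scalarCoord (metricCoord h p)))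
    (extChartAt 𝓘(ℝ, E) p p) (toCoord p p u))

/-- `(Hess R)(a, b)`, the Hessian of the scalar curvature. -/
def hessScalar (h : Metric E M) {p : M} (a b : TangentSpace 𝓘(ℝ, E) p) : ℝ :=
  hessCoord (metricCoord h p) (scalarCoord (metricCoord h p)) (extChartAt 𝓘(ℝ, E) p p)
    (toCoord p p a) (toCoord p p b)

/-! ## Backwards Ricci flow -/

/-- `g` is a smooth solution of the backwards Ricci flow `∂g/∂τ = 2 Ric(g)` on `M × [τ₁, τ₂]`,
complete on every time slice and with uniformly bounded curvature.  (Smoothness and the time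
derivative are one-sided at the two ends of the time interval.) -/
structure IsBackwardsRicciFlow (g : ℝ → Metric E M) (τ₁ τ₂ : ℝ) : Prop where
  smooth : ∀ p : M, ContDiffOn ℝ ∞ (fun z : ℝ × E => metricCoord (g z.1) p z.2)
    (Icc τ₁ τ₂ ×ˢ (extChartAt 𝓘(ℝ, E) p).target)
  flow : ∀ τ ∈ Icc τ₁ τ₂, ∀ (p : M) (a b : TangentSpace 𝓘(ℝ, E) p),
    HasDerivWithinAt (fun t => (g t).inner p a b) (2 * ricci (g τ) a b) (Icc τ₁ τ₂) τ
  complete : ∀ τ ∈ Icc τ₁ τ₂, IsCompleteMetric (g τ)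
  bounded : ∃ K : ℝ, ∀ τ ∈ Icc τ₁ τ₂, ∀ (p : M) (a b c d : TangentSpace 𝓘(ℝ, E) p),
    |(g τ).inner p (riemann (g τ) a b c) d|
      ≤ K * (len (g τ) a * len (g τ) b * len (g τ) c * len (g τ) d)

/-! ## Curves, and vector fields along curves, parametrized by an interval `s` -/

/-- The velocity vector `X(τ) = dγ/dτ`. -/
def velocity (γ : ℝ → M) (s : Set ℝ) (τ : ℝ) : TangentSpace 𝓘(ℝ, E) (γ τ) :=
  mfderivWithin 𝓘(ℝ, ℝ) 𝓘(ℝ, E) γ s τ (1 : ℝ)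

/-- The covariant derivative `(∇_X W)(τ)` of the vector field `W` along `γ` with respect to the
Levi-Civita connection of the (fixed) metric `h`. In the chart around `γ(τ)` it is
`dW/dτ + Γ(X, W)`. -/
def covDerivAlong (h : Metric E M) (γ : ℝ → M) (s : Set ℝ)
    (W : ∀ t, TangentSpace 𝓘(ℝ, E) (γ t)) (τ : ℝ) : TangentSpace 𝓘(ℝ, E) (γ τ) :=
  ofCoord (γ τ) (γ τ)
    (derivWithin (fun t => toCoord (γ τ) (γ t) (W t)) s τ
      + christoffel (metricCoord h (γ τ)) (extChartAt 𝓘(ℝ, E) (γ τ) (γ τ))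
          (toCoord (γ τ) (γ τ) (velocity γ s τ)) (toCoord (γ τ) (γ τ) (W τ)))

/-- `(∇_X U)(τ)`, with respect to the connection of `g(τ)`. -/
def nablaX (g : ℝ → Metric E M) (γ : ℝ → M) (s : Set ℝ)
    (U : ∀ t, TangentSpace 𝓘(ℝ, E) (γ t)) (τ : ℝ) : TangentSpace 𝓘(ℝ, E) (γ τ) :=
  covDerivAlong (g τ) γ s U τ

/-- `(∇_X ∇_X U)(τ)`: the second covariant derivative of `U` along `γ`, where, as for every
geometric quantity at time `τ`, the connection is that of the metric `g(τ)` at the time `τ`.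
(So the connection is frozen at time `τ` in both differentiations; the variation in time of the
connection does not enter.) -/
def nablaXX (g : ℝ → Metric E M) (γ : ℝ → M) (s : Set ℝ)
    (U : ∀ t, TangentSpace 𝓘(ℝ, E) (γ t)) (τ : ℝ) : TangentSpace 𝓘(ℝ, E) (γ τ) :=
  covDerivAlong (g τ) γ s (fun t => covDerivAlong (g τ) γ s U t) τ

/-- The vector field `W` along `γ` is smooth on `[a, b]`, `0 ≤ a`. Smoothness is measured in the
variable `σ = √τ`: the curve `σ ↦ (γ(σ²), W(σ²))` in the tangent bundle is smooth on `[√a, √b]`.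
For `a > 0` this is the same as smoothness in `τ`; for `a = 0` it is the natural notion along an
`ℒ`-geodesic, which is smooth in `√τ` but in general not differentiable in `τ` at `τ = 0`. -/
def SmoothFieldOn (γ : ℝ → M) (W : ∀ t, TangentSpace 𝓘(ℝ, E) (γ t)) (a b : ℝ) : Prop :=
  ContMDiffOn 𝓘(ℝ, ℝ) 𝓘(ℝ, E).tangent ∞
    (fun σ : ℝ => (⟨γ (σ ^ 2), W (σ ^ 2)⟩ : TangentBundle 𝓘(ℝ, E) M))
    (Icc (Real.sqrt a) (Real.sqrt b))

/-- The vector field `W` along `γ` is piecewise smooth on `[a, b]`: there is a finite partition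
`a = t₀ < t₁ < ⋯ < t_N = b` such that `W` is smooth on every closed interval `[t_i, t_{i+1}]`
(so that `W` is continuous). -/
def PiecewiseSmoothFieldOn (γ : ℝ → M) (W : ∀ t, TangentSpace 𝓘(ℝ, E) (γ t)) (a b : ℝ) : Prop :=
  ∃ (N : ℕ) (t : ℕ → ℝ), t 0 = a ∧ t N = b ∧
    ∀ i < N, t i < t (i + 1) ∧ SmoothFieldOn γ W (t i) (t (i + 1))

/-! ## `ℒ`-geodesics, the `ℒ`-index form and the `ℒ`-Jacobi operator -/

/-- `γ` is an `ℒ`-geodesic on `[τ₁, τ₂]`, `0 ≤ τ₁`: a continuous curve, smooth at positive times,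
which satisfies there the Euler-Lagrange equation
`∇_X X - (1/2) ∇R + (1/(2τ)) X + 2 Ric(X) = 0` of
`ℒ(γ) = ∫ √τ (R(γ(τ)) + |X(τ)|²) dτ`; if `τ₁ = 0`, then moreover the limit
`v = lim_{τ → 0} √τ X(τ)` exists in `T_{γ(0)}M`. -/
structure IsLGeodesic (g : ℝ → Metric E M) (γ : ℝ → M) (τ₁ τ₂ : ℝ) : Prop where
  continuousOn : ContinuousOn γ (Icc τ₁ τ₂)
  smooth : ContMDiffOn 𝓘(ℝ, ℝ) 𝓘(ℝ, E) ∞ γ (Icc τ₁ τ₂ ∩ Ioi 0)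
  equation : ∀ τ ∈ Icc τ₁ τ₂ ∩ Ioi 0,
    nablaX g γ (Icc τ₁ τ₂) (velocity γ (Icc τ₁ τ₂)) τ
      - (1 / 2 : ℝ) • gradScalar (g τ) (γ τ)
      + (1 / (2 * τ)) • velocity γ (Icc τ₁ τ₂) τ
      + (2 : ℝ) • ricciSharp (g τ) (velocity γ (Icc τ₁ τ₂) τ) = 0
  limit : τ₁ = 0 → ∃ v : TangentSpace 𝓘(ℝ, E) (γ 0),
    Tendsto
      (fun τ => (⟨γ τ, Real.sqrt τ • velocity γ (Icc τ₁ τ₂) τ⟩ : TangentBundle 𝓘(ℝ, E) M))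
      (𝓝[>] 0) (𝓝 ⟨γ 0, v⟩)

/-- The integrand of the `ℒ`-index form `I(U, V)`. -/
def indexIntegrand (g : ℝ → Metric E M) (γ : ℝ → M) (s : Set ℝ)
    (U V : ∀ t, TangentSpace 𝓘(ℝ, E) (γ t)) (τ : ℝ) : ℝ :=
  Real.sqrt τ *
    (hessScalar (g τ) (U τ) (V τ)
      + 2 * (g τ).inner (γ τ) (nablaX g γ s U τ) (nablaX g γ s V τ)
      + 2 * (g τ).inner (γ τ) (riemann (g τ) (U τ) (velocity γ s τ) (V τ)) (velocity γ s τ)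
      - 2 * nablaRicci (g τ) (U τ) (V τ) (velocity γ s τ)
      - 2 * nablaRicci (g τ) (V τ) (U τ) (velocity γ s τ)
      + 2 * nablaRicci (g τ) (velocity γ s τ) (U τ) (V τ))

/-- The `ℒ`-index form `I(U, V)` along `γ` on `[τ₁, τ₂]`. -/
def indexForm (g : ℝ → Metric E M) (γ : ℝ → M) (τ₁ τ₂ : ℝ)
    (U V : ∀ t, TangentSpace 𝓘(ℝ, E) (γ t)) : ℝ :=
  ∫ τ in τ₁..τ₂, indexIntegrand g γ (Icc τ₁ τ₂) U V τ

/-- The `ℒ`-Jacobi operator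
`∇_X∇_X U - R(X,U)X - (1/2) ∇_U(∇R) + 2 (∇_U Ric)(X) + 2 Ric(∇_X U) + (1/(2τ)) ∇_X U`. -/
def jacobiOperator (g : ℝ → Metric E M) (γ : ℝ → M) (s : Set ℝ)
    (U : ∀ t, TangentSpace 𝓘(ℝ, E) (γ t)) (τ : ℝ) : TangentSpace 𝓘(ℝ, E) (γ τ) :=
  nablaXX g γ s U τ
    - riemann (g τ) (velocity γ s τ) (U τ) (velocity γ s τ)
    - (1 / 2 : ℝ) • covDerivGradScalar (g τ) (U τ)
    + (2 : ℝ) • nablaRicciSharp (g τ) (U τ) (velocity γ s τ)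
    + (2 : ℝ) • ricciSharp (g τ) (nablaX g γ s U τ)
    + (1 / (2 * τ)) • nablaX g γ s U τ

/-- The function `τ ↦ √τ ⟨(ℒ-Jacobi operator applied to U), V⟩`. -/
def jacobiIntegrand (g : ℝ → Metric E M) (γ : ℝ → M) (s : Set ℝ)
    (U V : ∀ t, TangentSpace 𝓘(ℝ, E) (γ t)) (τ : ℝ) : ℝ :=
  Real.sqrt τ * (g τ).inner (γ τ) (jacobiOperator g γ s U τ) (V τ)

/-- The function `τ ↦ 2 √τ ⟨∇_X U, V⟩`. -/
def boundaryTerm (g : ℝ → Metric E M) (γ : ℝ → M) (s : Set ℝ)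
    (U V : ∀ t, TangentSpace 𝓘(ℝ, E) (γ t)) (τ : ℝ) : ℝ :=
  2 * Real.sqrt τ * (g τ).inner (γ τ) (nablaX g γ s U τ) (V τ)

end Manifold

end LGeom

end

/-! The formula is the fundamental theorem of calculus for `boundaryTerm`, the function 2√τ⟨∇_X U,
V⟩, because its derivative is the index integrand plus twice √τ⟨J(U), V⟩. The derivative has four
sources. The factor √τ produces the term ∇_X U/(2τ) of J. The moving metric, ∂_τ g = 2 Ric, produces
Ric(∇_X U). The product rule for the connection frozen at τ produces ⟨∇_X∇_X U, V⟩ + ⟨∇_X U, ∇_X V⟩.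
Finally the Levi-Civita connection itself moves, with ⟨Γ'(X,U), V⟩ = (∇_X Ric)(U,V) + (∇_U Ric)(X,V)
- (∇_V Ric)(X,U), and these are exactly the ∇Ric terms left over when I and 2J are added; the
curvature and Hessian terms cancel. The differentiation is `hasDerivAt_boundary`, built on
`inner_deriv_christoffelL`; the algebra is `index_add_jacobi`.

The end τ = 0 is handled in the variable σ = √τ, in which the curve and the fields are smooth up to
the end. Since ∂_τ = (2σ)⁻¹∂_σ, the boundary term is a smooth function H(σ) and the index integrand
is σ⁻¹K(σ) with K smooth, hence integrable. The derivative of H(√τ) is H'(σ)/(2σ), also integrable,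
so the integrability of √τ⟨J(U), V⟩ follows by subtraction.

Tensors at a point are defined in the chart around that point, while differentiating along the curve
needs one chart for nearby points. Transition maps are isometries of the coordinate metrics, and
`IsIsometryOn` shows that all the curvature quantities are natural under such maps. Compactness then
cuts the interval into pieces lying in single charts, with V smooth on each, and the boundary terms
telescope. -/

noncomputable section

namespace LGeom

set_option maxSynthPendingDepth 3
set_option linter.unusedSectionVars false

/-! ### Smooth parameter families, and the Levi-Civita connection of a coordinate metric. -/

section Coordinates

variable {E : Type*} [NormedAddCommGroup E] [NormedSpace ℝ E]
  {G : Type*} [NormedAddCommGroup G] [NormedSpace ℝ G]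

/-! ## Families of functions depending smoothly on a parameter -/

/-- `F t y` is jointly smooth on `I × O`. -/
def SmoothFamily (F : ℝ → E → G) (I : Set ℝ) (O : Set E) : Prop :=
  ContDiffOn ℝ ∞ (fun z : ℝ × E => F z.1 z.2) (I ×ˢ O)

theorem SmoothFamily.congr {F F' : ℝ → E → G} {I : Set ℝ} {O : Set E} (h : SmoothFamily F I O)
    (hF : ∀ t ∈ I, ∀ y ∈ O, F' t y = F t y) : SmoothFamily F' I O :=
  ContDiffOn.congr h fun z hz => hF z.1 hz.1 z.2 hz.2

theorem SmoothFamily.slice {F : ℝ → E → G} {I : Set ℝ} {O : Set E} (h : SmoothFamily F I O)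
    {t : ℝ} (ht : t ∈ I) : ContDiffOn ℝ ∞ (F t) O :=
  ContDiffOn.comp (g := fun z : ℝ × E => F z.1 z.2) (f := fun y => (t, y)) h
    (by fun_prop) fun _ hy => ⟨ht, hy⟩

theorem SmoothFamily.of_const {f : E → G} {I : Set ℝ} {O : Set E} (h : ContDiffOn ℝ ∞ f O) :
    SmoothFamily (fun _ => f) I O :=
  ContDiffOn.comp (g := f) (f := fun z : ℝ × E => z.2) h (by fun_prop) fun _ hz => hz.2

/-- Only the space variable is differentiated, so `I` may contain end points; on the open set `O`
the derivative within the set is the ordinary one. -/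
theorem SmoothFamily.smooth_fderiv {F : ℝ → E → G} {I : Set ℝ} {O : Set E} (hO : IsOpen O)
    (h : SmoothFamily F I O) : SmoothFamily (fun t y => fderiv ℝ (F t) y) I O := by
  intro z hz
  have h1 : ContDiffWithinAt ℝ ∞ (fun x : ℝ × E => fderivWithin ℝ (F x.1) O x.2) (I ×ˢ O) z := by
    refine ContDiffWithinAt.fderivWithin (f := fun x : ℝ × E => F x.1) (g := Prod.snd)
      (n := ∞) ?_ (by fun_prop) hO.uniqueDiffOn (by simp) hz (fun x hx => hx.2)
    have h2 := h z hz
    refine ContDiffWithinAt.comp (g := fun z : ℝ × E => F z.1 z.2)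
      (f := fun w : (ℝ × E) × E => (w.1.1, w.2)) (t := I ×ˢ O) (z, z.2) h2 (by fun_prop) ?_
    rintro ⟨x, w⟩ ⟨hx, hw⟩
    exact ⟨hx.1, hw⟩
  refine h1.congr (fun x hx => ?_) ?_
  · exact (fderivWithin_of_isOpen hO hx.2).symm
  · exact (fderivWithin_of_isOpen hO hz.2).symm

theorem SmoothFamily.clm_comp {F : ℝ → E → G} {I : Set ℝ} {O : Set E}
    {H : Type*} [NormedAddCommGroup H] [NormedSpace ℝ H] (L : G →L[ℝ] H)
    (h : SmoothFamily F I O) : SmoothFamily (fun t y => L (F t y)) I O :=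
  L.contDiff.comp_contDiffOn h

/-! ## Metrics in coordinates -/

/-- `B` is a smooth Riemannian metric on the open set `O`. -/
structure IsMetricOn (B : E → E →L[ℝ] E →L[ℝ] ℝ) (O : Set E) : Prop where
  isOpen : IsOpen O
  contDiffOn : ContDiffOn ℝ ∞ B O
  symm : ∀ y ∈ O, ∀ a b, B y a b = B y b a
  pos : ∀ y ∈ O, ∀ a, a ≠ 0 → 0 < B y a a

/-- `B t`, `t ∈ I`, is a family of smooth Riemannian metrics on `O`, smooth in `(t, y)`. -/
structure IsMetricFamily (B : ℝ → E → E →L[ℝ] E →L[ℝ] ℝ) (I : Set ℝ) (O : Set E) : Prop where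
  isOpen : IsOpen O
  smooth : SmoothFamily B I O
  symm : ∀ t ∈ I, ∀ y ∈ O, ∀ a b, B t y a b = B t y b a
  pos : ∀ t ∈ I, ∀ y ∈ O, ∀ a, a ≠ 0 → 0 < B t y a a

theorem IsMetricFamily.slice {B : ℝ → E → E →L[ℝ] E →L[ℝ] ℝ} {I : Set ℝ} {O : Set E}
    (h : IsMetricFamily B I O) {t : ℝ} (ht : t ∈ I) : IsMetricOn (B t) O :=
  ⟨h.isOpen, h.smooth.slice ht, h.symm t ht, h.pos t ht⟩

theorem IsMetricOn.family {B : E → E →L[ℝ] E →L[ℝ] ℝ} {O : Set E} (h : IsMetricOn B O) :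
    IsMetricFamily (fun _ => B) univ O :=
  ⟨h.isOpen, .of_const h.contDiffOn, fun _ _ => h.symm, fun _ _ => h.pos⟩

theorem IsMetricOn.mono {B : E → E →L[ℝ] E →L[ℝ] ℝ} {O O' : Set E} (h : IsMetricOn B O)
    (hO : IsOpen O') (hs : O' ⊆ O) : IsMetricOn B O' :=
  ⟨hO, h.contDiffOn.mono hs, fun y hy => h.symm y (hs hy), fun y hy => h.pos y (hs hy)⟩

theorem differentiableAt_of_contDiffOn {f : E → G} {O : Set E} (hO : IsOpen O)
    (h : ContDiffOn ℝ ∞ f O) {y : E} (hy : y ∈ O) : DifferentiableAt ℝ f y :=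
  (h.contDiffAt (hO.mem_nhds hy)).differentiableAt (by simp)

theorem contDiffOn_fderiv {f : E → G} {O : Set E} (hO : IsOpen O)
    (h : ContDiffOn ℝ ∞ f O) : ContDiffOn ℝ ∞ (fderiv ℝ f) O :=
  h.fderiv_of_isOpen hO (by simp)

/-- Twice the Christoffel symbols with the last index lowered, as a bundled trilinear map. -/
def koszulL (B : E → E →L[ℝ] E →L[ℝ] ℝ) (y : E) : E →L[ℝ] E →L[ℝ] E →L[ℝ] ℝ :=
  fderiv ℝ B y + (fderiv ℝ B y).flip
    - (ContinuousLinearMap.flipₗᵢ ℝ E E ℝ).toContinuousLinearEquiv.toContinuousLinearMap ∘L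
        (fderiv ℝ B y).flip

theorem koszulL_apply (B : E → E →L[ℝ] E →L[ℝ] ℝ) (y a b c : E) :
    koszulL B y a b c
      = fderiv ℝ B y a b c + fderiv ℝ B y b a c - fderiv ℝ B y c a b := by
  simp [koszulL]

/-- The Christoffel symbols as a bundled bilinear map. -/
def christoffelL (B : E → E →L[ℝ] E →L[ℝ] ℝ) (y : E) : E →L[ℝ] E →L[ℝ] E :=
  (1 / 2 : ℝ) • (ContinuousLinearMap.compL ℝ E (E →L[ℝ] ℝ) E (B y).inverse ∘L koszulL B y)

theorem christoffelL_apply (B : E → E →L[ℝ] E →L[ℝ] ℝ) (y a b : E) :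
    christoffelL B y a b = (1 / 2 : ℝ) • sharp B y (koszulL B y a b) := by
  simp [christoffelL, sharp]

/-- Derivatives of components along fixed vectors are evaluations of the derivative of `B`. The
bundled form is the one that can be differentiated again. -/
theorem koszulForm_eq {B : E → E →L[ℝ] E →L[ℝ] ℝ} {y : E} (h : DifferentiableAt ℝ B y)
    (a b : E) : koszulForm B y a b = koszulL B y a b := by
  ext c
  have h1 : ∀ b a, fderiv ℝ (fun z => B z b) y a = fderiv ℝ B y a b := fun b a => by
    rw [fderiv_clm_apply h (by fun_prop)]; simp
  have h2 : ∀ a b c, fderiv ℝ (fun z => B z a b) y c = fderiv ℝ B y c a b := fun a b c => by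
    rw [fderiv_clm_apply (by fun_prop) (by fun_prop), fderiv_clm_apply h (by fun_prop)]; simp
  simp [koszulForm, koszulL_apply, h1, h2]

theorem christoffel_eq {B : E → E →L[ℝ] E →L[ℝ] ℝ} {y : E} (h : DifferentiableAt ℝ B y)
    (a b : E) : christoffel B y a b = christoffelL B y a b := by
  rw [christoffel, christoffelL_apply, koszulForm_eq h]

section Metric

variable {B : E → E →L[ℝ] E →L[ℝ] ℝ} {O : Set E} {y : E}

theorem IsMetricOn.differentiableAt (h : IsMetricOn B O) (hy : y ∈ O) : DifferentiableAt ℝ B y :=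
  differentiableAt_of_contDiffOn h.isOpen h.contDiffOn hy

theorem IsMetricOn.christoffel (h : IsMetricOn B O) (hy : y ∈ O) (a b : E) :
    christoffel B y a b = christoffelL B y a b :=
  christoffel_eq (h.differentiableAt hy) a b

theorem IsMetricOn.ext (h : IsMetricOn B O) (hy : y ∈ O) {v w : E}
    (hvw : ∀ c, B y v c = B y w c) : v = w := by
  by_contra hne
  have h1 := h.pos y hy (v - w) (sub_ne_zero.2 hne)
  have h2 := hvw (v - w)
  rw [map_sub (B y), sub_apply, h2, sub_self] at h1
  exact lt_irrefl _ h1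

variable [FiniteDimensional ℝ E]

/-- `ContinuousLinearMap.inverse` has a default value off the invertible maps, so `sharp` raises an
index only once the metric is known to be an equivalence. Injectivity suffices because `E` and its
dual have equal dimension. -/
theorem exists_equiv_of_injective {A : E →L[ℝ] E →L[ℝ] ℝ} (h : Function.Injective A) :
    ∃ e : E ≃L[ℝ] (E →L[ℝ] ℝ), (e : E →L[ℝ] E →L[ℝ] ℝ) = A := by
  have hd : Module.finrank ℝ E = Module.finrank ℝ (E →L[ℝ] ℝ) := by
    rw [← (LinearMap.toContinuousLinearMap (𝕜 := ℝ) (E := E) (F' := ℝ)).finrank_eq]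
    exact (Subspace.dual_finrank_eq (K := ℝ) (V := E)).symm
  refine ⟨(LinearEquiv.ofInjectiveOfFinrankEq (A : E →ₗ[ℝ] E →L[ℝ] ℝ) h hd).toContinuousLinearEquiv,
    ?_⟩
  ext a b
  rfl

theorem IsMetricOn.exists_equiv (h : IsMetricOn B O) (hy : y ∈ O) :
    ∃ e : E ≃L[ℝ] (E →L[ℝ] ℝ), (e : E →L[ℝ] E →L[ℝ] ℝ) = B y :=
  exists_equiv_of_injective fun v w hvw => h.ext hy fun c => by rw [hvw]

theorem IsMetricOn.apply_sharp (h : IsMetricOn B O) (hy : y ∈ O) (ℓ : E →L[ℝ] ℝ) :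
    B y (sharp B y ℓ) = ℓ := by
  obtain ⟨e, he⟩ := h.exists_equiv hy
  rw [sharp, ← he, ContinuousLinearMap.inverse_equiv]
  simp

theorem IsMetricOn.apply_christoffelL (h : IsMetricOn B O) (hy : y ∈ O) (a b c : E) :
    2 * B y (christoffelL B y a b) c
      = fderiv ℝ B y a b c + fderiv ℝ B y b a c - fderiv ℝ B y c a b := by
  rw [christoffelL_apply, map_smul, h.apply_sharp hy, ← koszulL_apply]
  simp

theorem IsMetricOn.fderiv_symm (h : IsMetricOn B O) (hy : y ∈ O) (a b c : E) :
    fderiv ℝ B y a b c = fderiv ℝ B y a c b := by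
  have h0 := h.differentiableAt hy
  have h2 : ∀ b c a, fderiv ℝ (fun z => B z b c) y a = fderiv ℝ B y a b c := fun b c a => by
    rw [fderiv_clm_apply (by fun_prop) (by fun_prop), fderiv_clm_apply h0 (by fun_prop)]; simp
  rw [← h2, ← h2]
  have : (fun z => B z b c) =ᶠ[𝓝 y] fun z => B z c b :=
    Filter.eventuallyEq_of_mem (h.isOpen.mem_nhds hy) fun z hz => h.symm z hz b c
  rw [this.fderiv_eq]

theorem IsMetricOn.christoffelL_symm (h : IsMetricOn B O) (hy : y ∈ O) (a b : E) :
    christoffelL B y a b = christoffelL B y b a := by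
  refine h.ext hy fun c => ?_
  have h1 := h.apply_christoffelL hy a b c
  have h2 := h.apply_christoffelL hy b a c
  have h3 := h.fderiv_symm hy c a b
  linarith

/-- The connection is metric: in the sum of the Koszul formulas for (a,b,c) and (a,c,b) all but the
derivative along a cancel, by symmetry of the metric. -/
theorem IsMetricOn.compat (h : IsMetricOn B O) (hy : y ∈ O) (a b c : E) :
    fderiv ℝ B y a b c
      = B y (christoffelL B y a b) c + B y b (christoffelL B y a c) := by
  have h1 := h.apply_christoffelL hy a b c
  have h2 := h.apply_christoffelL hy a c b
  have h3 := h.fderiv_symm hy a b c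
  have h4 := h.fderiv_symm hy b a c
  have h5 := h.fderiv_symm hy c a b
  rw [h.symm y hy b]
  linarith

end Metric

/-! ## Joint smoothness of the curvature quantities -/

variable [FiniteDimensional ℝ E] {B : ℝ → E → E →L[ℝ] E →L[ℝ] ℝ} {I : Set ℝ} {O : Set E}

theorem IsMetricFamily.smooth_inverse (h : IsMetricFamily B I O) :
    SmoothFamily (fun t y => (B t y).inverse) I O := by
  intro z hz
  obtain ⟨e, he⟩ := (h.slice hz.1).exists_equiv hz.2
  have h1 : ContDiffAt ℝ ∞ ContinuousLinearMap.inverse (B z.1 z.2) := by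
    rw [← he]; exact contDiffAt_map_inverse e
  exact h1.comp_contDiffWithinAt z (h.smooth z hz)

theorem IsMetricFamily.smooth_koszulL (h : IsMetricFamily B I O) :
    SmoothFamily (fun t => koszulL (B t)) I O := by
  have h1 := h.smooth.smooth_fderiv h.isOpen
  have h2 : SmoothFamily (fun t y => (fderiv ℝ (B t) y).flip) I O :=
    h1.clm_comp (ContinuousLinearMap.flipₗᵢ ℝ E E (E →L[ℝ] ℝ)).toContinuousLinearEquiv.toContinuousLinearMap
  have h3 := h2.clm_comp (ContinuousLinearMap.compL ℝ E (E →L[ℝ] E →L[ℝ] ℝ) (E →L[ℝ] E →L[ℝ] ℝ)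
    (ContinuousLinearMap.flipₗᵢ ℝ E E ℝ).toContinuousLinearEquiv.toContinuousLinearMap)
  exact (ContDiffOn.add h1 h2).sub h3

theorem IsMetricFamily.smooth_christoffelL (h : IsMetricFamily B I O) :
    SmoothFamily (fun t => christoffelL (B t)) I O := by
  have h1 := h.smooth_inverse.clm_comp (ContinuousLinearMap.compL ℝ E (E →L[ℝ] ℝ) E)
  have h2 := h.smooth_koszulL
  exact ContDiffOn.const_smul (1 / 2 : ℝ) (ContDiffOn.clm_comp h1 h2)

theorem IsMetricOn.contDiffOn_christoffelL {B : E → E →L[ℝ] E →L[ℝ] ℝ} (h : IsMetricOn B O) :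
    ContDiffOn ℝ ∞ (christoffelL B) O :=
  h.family.smooth_christoffelL.slice (mem_univ 0)

end Coordinates

/-! ### Curvature, its symmetries and covariant derivatives in coordinates. -/

section Curvature

variable {E : Type*} [NormedAddCommGroup E] [NormedSpace ℝ E]
  {G : Type*} [NormedAddCommGroup G] [NormedSpace ℝ G]

/-! ## Curvature in coordinates -/

theorem fderiv_clm_apply_const {H : Type*} [NormedAddCommGroup H] [NormedSpace ℝ H]
    {A : E → G →L[ℝ] H} {y : E} (h : DifferentiableAt ℝ A y) (b : G) (a : E) :
    fderiv ℝ (fun z => A z b) y a = fderiv ℝ A y a b := by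
  rw [fderiv_clm_apply h (by fun_prop)]; simp

theorem fderiv_clm_apply₂_const {K H : Type*} [NormedAddCommGroup H] [NormedSpace ℝ H]
    [NormedAddCommGroup K] [NormedSpace ℝ K]
    {A : E → G →L[ℝ] K →L[ℝ] H} {y : E} (h : DifferentiableAt ℝ A y) (b : G) (c : K) (a : E) :
    fderiv ℝ (fun z => A z b c) y a = fderiv ℝ A y a b c := by
  rw [fderiv_clm_apply_const (A := fun z => A z b) (h.clm_apply (by fun_prop)),
    fderiv_clm_apply_const h]

/-- The passage to the basis-free trace makes conjugation invariance available for Ricci and scalar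
curvature. -/
theorem traceOf_linearMap [FiniteDimensional ℝ E] (f : E →ₗ[ℝ] E) :
    traceOf f = LinearMap.trace ℝ E f := by
  classical
  rw [LinearMap.trace_eq_matrix_trace ℝ (Module.finBasis ℝ E), Matrix.trace]
  simp [traceOf, LinearMap.toMatrix_apply]

theorem formOf_clm [FiniteDimensional ℝ E] (ℓ : E →L[ℝ] ℝ) : formOf (fun x => ℓ x) = ℓ := by
  ext x
  have : (Module.finBasis ℝ E).constr ℝ (fun i => ℓ (Module.finBasis ℝ E i)) = (ℓ : E →ₗ[ℝ] ℝ) :=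
    (Module.finBasis ℝ E).constr_eq ℝ fun i => rfl
  simp [formOf, this]

/-- The curvature tensor as an explicit expression in the bundled Christoffel symbols. -/
def riemannF (B : E → E →L[ℝ] E →L[ℝ] ℝ) (y a b c : E) : E :=
  (fderiv ℝ (christoffelL B) y a b c + christoffelL B y a (christoffelL B y b c))
    - (fderiv ℝ (christoffelL B) y b a c + christoffelL B y b (christoffelL B y a c))

/-- The endomorphism `a ↦ R(a, b)c`. -/
def riemannEnd (B : E → E →L[ℝ] E →L[ℝ] ℝ) (y b c : E) : E →ₗ[ℝ] E where
  toFun a := riemannF B y a b c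
  map_add' a a' := by simp only [riemannF, map_add, add_apply]; abel
  map_smul' r a := by
    simp only [riemannF, map_smul, smul_apply, RingHom.id_apply, smul_sub, smul_add]

theorem riemannF_antisymm (B : E → E →L[ℝ] E →L[ℝ] ℝ) (y a b c : E) :
    riemannF B y a b c = -riemannF B y b a c := by
  simp [riemannF]

variable [FiniteDimensional ℝ E]

/-- The Ricci tensor as a bundled bilinear form. -/
def ricciL (B : E → E →L[ℝ] E →L[ℝ] ℝ) (y : E) : E →L[ℝ] E →L[ℝ] ℝ :=
  LinearMap.toContinuousLinearMap ((LinearMap.toContinuousLinearMap :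
    (E →ₗ[ℝ] ℝ) ≃ₗ[ℝ] (E →L[ℝ] ℝ)).toLinearMap ∘ₗ
    LinearMap.mk₂ ℝ (fun b c => traceOf fun a => riemannF B y a b c)
      (fun b b' c => by
        simp only [traceOf, ← Finset.sum_add_distrib, ← map_add]
        refine Finset.sum_congr rfl fun i _ => congrArg _ ?_
        simp only [riemannF, map_add, add_apply]; abel)
      (fun r b c => by
        simp only [traceOf, Finset.smul_sum, ← map_smul]
        refine Finset.sum_congr rfl fun i _ => congrArg _ ?_
        simp only [riemannF, map_smul, smul_apply, smul_sub, smul_add])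
      (fun b c c' => by
        simp only [traceOf, ← Finset.sum_add_distrib, ← map_add]
        refine Finset.sum_congr rfl fun i _ => congrArg _ ?_
        simp only [riemannF, map_add]; abel)
      (fun r b c => by
        simp only [traceOf, Finset.smul_sum, ← map_smul]
        refine Finset.sum_congr rfl fun i _ => congrArg _ ?_
        simp only [riemannF, map_smul, smul_sub, smul_add]))

theorem ricciL_apply (B : E → E →L[ℝ] E →L[ℝ] ℝ) (y b c : E) :
    ricciL B y b c = traceOf fun a => riemannF B y a b c := by
  simp [ricciL]

theorem ricciL_eq_trace (B : E → E →L[ℝ] E →L[ℝ] ℝ) (y b c : E) :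
    ricciL B y b c = LinearMap.trace ℝ E (riemannEnd B y b c) := by
  rw [ricciL_apply, ← traceOf_linearMap]; rfl

/-- The Ricci endomorphism as a linear map. -/
def ricciEnd (B : E → E →L[ℝ] E →L[ℝ] ℝ) (y : E) : E →ₗ[ℝ] E :=
  ((B y).inverse ∘L ricciL B y : E →L[ℝ] E)

section Metric

variable {B : E → E →L[ℝ] E →L[ℝ] ℝ} {O : Set E} {y : E}

theorem IsMetricOn.differentiableAt_christoffelL (h : IsMetricOn B O) (hy : y ∈ O) :
    DifferentiableAt ℝ (christoffelL B) y :=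
  differentiableAt_of_contDiffOn h.isOpen h.contDiffOn_christoffelL hy

theorem IsMetricOn.riemannCoord (h : IsMetricOn B O) (hy : y ∈ O) (a b c : E) :
    riemannCoord B y a b c = riemannF B y a b c := by
  have h1 : ∀ b c a, fderiv ℝ (fun z => LGeom.christoffel B z b c) y a
      = fderiv ℝ (christoffelL B) y a b c := fun b c a => by
    rw [← fderiv_clm_apply₂_const (h.differentiableAt_christoffelL hy)]
    have : (fun z => LGeom.christoffel B z b c) =ᶠ[𝓝 y] fun z => christoffelL B z b c :=
      Filter.eventuallyEq_of_mem (h.isOpen.mem_nhds hy) fun z hz => h.christoffel hz b c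
    rw [this.fderiv_eq]
  simp only [LGeom.riemannCoord, riemannF, h1, h.christoffel hy]

/-- Differentiating the compatibility of the connection with the metric. -/
theorem IsMetricOn.fderiv_compat (h : IsMetricOn B O) (hy : y ∈ O) (a b c d : E) :
    fderiv ℝ (fderiv ℝ B) y a b c d
      = B y (fderiv ℝ (christoffelL B) y a b c + christoffelL B y a (christoffelL B y b c)) d
        + B y c (fderiv ℝ (christoffelL B) y a b d + christoffelL B y a (christoffelL B y b d))
        + B y (christoffelL B y b c) (christoffelL B y a d)
        + B y (christoffelL B y a c) (christoffelL B y b d) := by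
  have hB := h.differentiableAt hy
  have hΓ := h.differentiableAt_christoffelL hy
  have hD : DifferentiableAt ℝ (fderiv ℝ B) y :=
    differentiableAt_of_contDiffOn h.isOpen (contDiffOn_fderiv h.isOpen h.contDiffOn) hy
  have e : (fun z => fderiv ℝ B z b c d) =ᶠ[𝓝 y]
      fun z => B z (christoffelL B z b c) d + B z c (christoffelL B z b d) :=
    Filter.eventuallyEq_of_mem (h.isOpen.mem_nhds hy) fun z hz => h.compat hz b c d
  have hl : fderiv ℝ (fun z => fderiv ℝ B z b c d) y a = fderiv ℝ (fderiv ℝ B) y a b c d := by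
    rw [fderiv_clm_apply_const (A := fun z => fderiv ℝ B z b c) (by fun_prop),
      fderiv_clm_apply₂_const hD]
  have h1 : ∀ c, HasFDerivAt (fun z => christoffelL B z b c)
      ((fderiv ℝ (christoffelL B) y).flip b |>.flip c) y := fun c => by
    have := (hΓ.hasFDerivAt.clm_apply (hasFDerivAt_const b y)).clm_apply (hasFDerivAt_const c y)
    convert! this using 1
    ext w; simp
  have h2 : HasFDerivAt (fun z => B z (christoffelL B z b c) d) _ y :=
    (hB.hasFDerivAt.clm_apply (h1 c)).clm_apply (hasFDerivAt_const d y)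
  have h3 : HasFDerivAt (fun z => B z c (christoffelL B z b d)) _ y :=
    (hB.hasFDerivAt.clm_apply (hasFDerivAt_const c y)).clm_apply (h1 d)
  rw [← hl, e.fderiv_eq, (h2.fun_add h3).fderiv]
  simp
  rw [h.compat hy a (christoffelL B y b c) d, h.compat hy a c (christoffelL B y b d)]
  ring

theorem IsMetricOn.fderiv_fderiv_symm (h : IsMetricOn B O) (hy : y ∈ O) (a b : E) :
    fderiv ℝ (fderiv ℝ B) y a b = fderiv ℝ (fderiv ℝ B) y b a :=
  ((h.contDiffOn.contDiffAt (h.isOpen.mem_nhds hy)).isSymmSndFDerivAt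
    (by simpa using WithTop.coe_le_coe.2 (le_top : (2 : ℕ∞) ≤ ⊤))) a b

/-- Second derivatives of the metric are symmetric in a and b. Antisymmetrizing `fderiv_compat`
therefore gives zero on the left, the products of two Christoffel terms cancel on the right, and
⟨R(a,b)c, d⟩ + ⟨c, R(a,b)d⟩ = 0 remains. -/
theorem IsMetricOn.riemannF_skew (h : IsMetricOn B O) (hy : y ∈ O) (a b c d : E) :
    B y (riemannF B y a b c) d = -B y (riemannF B y a b d) c := by
  have h1 := h.fderiv_compat hy a b c d
  have h2 := h.fderiv_compat hy b a c d
  rw [h.fderiv_fderiv_symm hy a b, h2] at h1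
  rw [h.symm y hy _ c]
  simp only [riemannF, map_sub, sub_apply]
  linarith

theorem IsMetricOn.ricciCoord (h : IsMetricOn B O) (hy : y ∈ O) (b c : E) :
    ricciCoord B y b c = ricciL B y b c := by
  simp only [LGeom.ricciCoord, ricciL_apply, h.riemannCoord hy]

theorem IsMetricOn.ricciSharpCoord (h : IsMetricOn B O) (hy : y ∈ O) (a : E) :
    ricciSharpCoord B y a = ricciEnd B y a := by
  have : LGeom.ricciCoord B y a = fun c => ricciL B y a c := funext fun c => h.ricciCoord hy a c
  rw [LGeom.ricciSharpCoord, this, formOf_clm]; rfl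

theorem IsMetricOn.inner_ricciEnd (h : IsMetricOn B O) (hy : y ∈ O) (a c : E) :
    B y (ricciEnd B y a) c = ricciL B y a c :=
  congrArg (fun ℓ : E →L[ℝ] ℝ => ℓ c) (h.apply_sharp hy (ricciL B y a))

theorem IsMetricOn.scalarCoord (h : IsMetricOn B O) (hy : y ∈ O) :
    scalarCoord B y = LinearMap.trace ℝ E (ricciEnd B y) := by
  have : LGeom.ricciSharpCoord B y = ricciEnd B y := funext fun c => h.ricciSharpCoord hy c
  rw [LGeom.scalarCoord, this, traceOf_linearMap]

end Metric

/-! ## Smooth dependence -/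

section Family

variable {B : ℝ → E → E →L[ℝ] E →L[ℝ] ℝ} {I : Set ℝ} {O : Set E}

theorem IsMetricFamily.smooth_ricciL (h : IsMetricFamily B I O) :
    SmoothFamily (fun t => ricciL (B t)) I O := by
  have h1 : ContDiffOn ℝ ∞ (fun z : ℝ × E => christoffelL (B z.1) z.2) (I ×ˢ O) :=
    h.smooth_christoffelL
  have h2 : ContDiffOn ℝ ∞ (fun z : ℝ × E => fderiv ℝ (christoffelL (B z.1)) z.2) (I ×ˢ O) :=
    h.smooth_christoffelL.smooth_fderiv h.isOpen
  refine contDiffOn_clm_apply.2 fun b => contDiffOn_clm_apply.2 fun c => ?_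
  simp only [ricciL_apply, traceOf]
  refine ContDiffOn.sum fun i _ => ?_
  refine (LinearMap.toContinuousLinearMap
    ((Module.finBasis ℝ E).coord i)).contDiff.comp_contDiffOn (f := fun z : ℝ × E =>
      riemannF (B z.1) z.2 (Module.finBasis ℝ E i) b c) ?_
  unfold riemannF
  fun_prop

theorem IsMetricFamily.smooth_scalarCoord (h : IsMetricFamily B I O) :
    SmoothFamily (fun t => scalarCoord (B t)) I O := by
  have h1 : ContDiffOn ℝ ∞ (fun z : ℝ × E => ricciL (B z.1) z.2) (I ×ˢ O) := h.smooth_ricciL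
  have h2 : ContDiffOn ℝ ∞ (fun z : ℝ × E => (B z.1 z.2).inverse) (I ×ˢ O) := h.smooth_inverse
  have h3 : SmoothFamily (fun t y => LinearMap.trace ℝ E (ricciEnd (B t) y)) I O := by
    simp only [← traceOf_linearMap, traceOf]
    refine ContDiffOn.sum fun i _ => ?_
    refine (LinearMap.toContinuousLinearMap
      ((Module.finBasis ℝ E).coord i)).contDiff.comp_contDiffOn (f := fun z : ℝ × E =>
        ricciEnd (B z.1) z.2 (Module.finBasis ℝ E i)) ?_
    simp only [ricciEnd, ContinuousLinearMap.coe_coe, ContinuousLinearMap.comp_apply]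
    fun_prop
  exact h3.congr fun t ht y hy => (h.slice ht).scalarCoord hy

theorem IsMetricFamily.smooth_gradCoord (h : IsMetricFamily B I O) :
    SmoothFamily (fun t => gradCoord (B t) (scalarCoord (B t))) I O := by
  have h1 : ContDiffOn ℝ ∞ (fun z : ℝ × E => fderiv ℝ (scalarCoord (B z.1)) z.2) (I ×ˢ O) :=
    h.smooth_scalarCoord.smooth_fderiv h.isOpen
  have h2 : ContDiffOn ℝ ∞ (fun z : ℝ × E => (B z.1 z.2).inverse) (I ×ˢ O) := h.smooth_inverse
  exact h2.clm_apply h1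

end Family

/-! ## Covariant derivatives of the scalar curvature and of the Ricci tensor -/

variable {B : E → E →L[ℝ] E →L[ℝ] ℝ} {O : Set E} {y : E}

theorem IsMetricOn.contDiffOn_ricciL (h : IsMetricOn B O) : ContDiffOn ℝ ∞ (ricciL B) O :=
  h.family.smooth_ricciL.slice (mem_univ 0)

theorem IsMetricOn.contDiffOn_scalarCoord (h : IsMetricOn B O) :
    ContDiffOn ℝ ∞ (LGeom.scalarCoord B) O :=
  h.family.smooth_scalarCoord.slice (mem_univ 0)

theorem IsMetricOn.contDiffOn_gradCoord (h : IsMetricOn B O) :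
    ContDiffOn ℝ ∞ (gradCoord B (LGeom.scalarCoord B)) O :=
  h.family.smooth_gradCoord.slice (mem_univ 0)

theorem IsMetricOn.covDerivCoord (h : IsMetricOn B O) (hy : y ∈ O) (Y : E → E) (u : E) :
    covDerivCoord B Y y u = fderiv ℝ Y y u + christoffelL B y u (Y y) := by
  rw [LGeom.covDerivCoord, h.christoffel hy]

/-- Differentiate dR(b) = ⟨∇R, b⟩ and use compatibility of the connection with the metric. -/
theorem IsMetricOn.hessCoord (h : IsMetricOn B O) (hy : y ∈ O) (a b : E) :
    hessCoord B (LGeom.scalarCoord B) y a b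
      = B y (LGeom.covDerivCoord B (gradCoord B (LGeom.scalarCoord B)) y a) b := by
  have hB := h.differentiableAt hy
  have hs := contDiffOn_fderiv h.isOpen h.contDiffOn_scalarCoord
  have hs' := differentiableAt_of_contDiffOn h.isOpen hs hy
  have hg := differentiableAt_of_contDiffOn h.isOpen h.contDiffOn_gradCoord hy
  have e : (fun z => fderiv ℝ (LGeom.scalarCoord B) z b) =ᶠ[𝓝 y]
      fun z => B z (gradCoord B (LGeom.scalarCoord B) z) b :=
    Filter.eventuallyEq_of_mem (h.isOpen.mem_nhds hy) fun z hz =>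
      (congrArg (fun ℓ : E →L[ℝ] ℝ => ℓ b) (h.apply_sharp hz _)).symm
  have h2 : HasFDerivAt (fun z => B z (gradCoord B (LGeom.scalarCoord B) z) b) _ y :=
    (hB.hasFDerivAt.clm_apply hg.hasFDerivAt).clm_apply (hasFDerivAt_const b y)
  have h3 : fderiv ℝ (LGeom.scalarCoord B) y (christoffelL B y a b)
      = B y (gradCoord B (LGeom.scalarCoord B) y) (christoffelL B y a b) :=
    (congrArg (fun ℓ : E →L[ℝ] ℝ => ℓ (christoffelL B y a b)) (h.apply_sharp hy _)).symm
  rw [LGeom.hessCoord, e.fderiv_eq, h2.fderiv, h.christoffel hy, h.covDerivCoord hy, h3]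
  simp [h.compat hy]
  ring

theorem IsMetricOn.nablaRicciCoord (h : IsMetricOn B O) (hy : y ∈ O) (u a c : E) :
    nablaRicciCoord B y u a c = fderiv ℝ (ricciL B) y u a c
      - ricciL B y (christoffelL B y u a) c - ricciL B y a (christoffelL B y u c) := by
  have hr := differentiableAt_of_contDiffOn h.isOpen h.contDiffOn_ricciL hy
  have e : (fun z => LGeom.ricciCoord B z a c) =ᶠ[𝓝 y] fun z => ricciL B z a c :=
    Filter.eventuallyEq_of_mem (h.isOpen.mem_nhds hy) fun z hz => h.ricciCoord hz a c
  rw [LGeom.nablaRicciCoord, e.fderiv_eq, fderiv_clm_apply₂_const hr]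
  simp only [h.ricciCoord hy, h.christoffel hy]

theorem IsMetricOn.inner_nablaRicciSharpCoord (h : IsMetricOn B O) (hy : y ∈ O) (u a c : E) :
    B y (nablaRicciSharpCoord B y u a) c = LGeom.nablaRicciCoord B y u a c := by
  -- `formOf` reads only the values on a basis, so the last slot is exhibited as a genuine
  -- continuous linear form.
  have : LGeom.nablaRicciCoord B y u a = fun c =>
      ((fderiv ℝ (ricciL B) y u a - ricciL B y (christoffelL B y u a)
        - ricciL B y a ∘L christoffelL B y u : E →L[ℝ] ℝ)) c :=
    funext fun c => by rw [h.nablaRicciCoord hy]; simp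
  rw [LGeom.nablaRicciSharpCoord, this, formOf_clm, h.apply_sharp hy]

end Curvature

/-! ### Naturality of the connection and curvature under isometries. -/

section Invariance

variable {E : Type*} [NormedAddCommGroup E] [NormedSpace ℝ E]

/-! ## Invariance under changes of coordinates -/

/-- `Φ` is a smooth map from `O` to `O'` with `Φ^* B' = B`. -/
structure IsIsometryOn (Φ : E → E) (B B' : E → E →L[ℝ] E →L[ℝ] ℝ) (O O' : Set E) : Prop where
  left : IsMetricOn B O
  right : IsMetricOn B' O'
  contDiffOn : ContDiffOn ℝ ∞ Φ O
  mapsTo : MapsTo Φ O O'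
  pullback : ∀ y ∈ O, ∀ a b, B y a b = B' (Φ y) (fderiv ℝ Φ y a) (fderiv ℝ Φ y b)

variable {Φ : E → E} {B B' : E → E →L[ℝ] E →L[ℝ] ℝ} {O O' : Set E} {y : E}

theorem fderiv_fderiv_symm {G : Type*} [NormedAddCommGroup G] [NormedSpace ℝ G] {f : E → G}
    (hO : IsOpen O) (hf : ContDiffOn ℝ ∞ f O) (hy : y ∈ O) (a b : E) :
    fderiv ℝ (fderiv ℝ f) y a b = fderiv ℝ (fderiv ℝ f) y b a :=
  ((hf.contDiffAt (hO.mem_nhds hy)).isSymmSndFDerivAt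
    (by simpa using WithTop.coe_le_coe.2 (le_top : (2 : ℕ∞) ≤ ⊤))) a b

namespace IsIsometryOn

theorem hasFDerivAt (h : IsIsometryOn Φ B B' O O') (hy : y ∈ O) :
    HasFDerivAt Φ (fderiv ℝ Φ y) y :=
  (differentiableAt_of_contDiffOn h.left.isOpen h.contDiffOn hy).hasFDerivAt

theorem hasFDerivAt_fderiv (h : IsIsometryOn Φ B B' O O') (hy : y ∈ O) :
    HasFDerivAt (fderiv ℝ Φ) (fderiv ℝ (fderiv ℝ Φ) y) y :=
  (differentiableAt_of_contDiffOn h.left.isOpen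
    (contDiffOn_fderiv h.left.isOpen h.contDiffOn) hy).hasFDerivAt

theorem hasFDerivAt_fderiv_fderiv (h : IsIsometryOn Φ B B' O O') (hy : y ∈ O) :
    HasFDerivAt (fderiv ℝ (fderiv ℝ Φ)) (fderiv ℝ (fderiv ℝ (fderiv ℝ Φ)) y) y :=
  (differentiableAt_of_contDiffOn h.left.isOpen
    (contDiffOn_fderiv h.left.isOpen (contDiffOn_fderiv h.left.isOpen h.contDiffOn))
    hy).hasFDerivAt

/-- The derivative of a bilinear form pulled back by `Φ`. -/
theorem fderiv_pullback {G : Type*} [NormedAddCommGroup G] [NormedSpace ℝ G]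
    {T' : E → E →L[ℝ] E →L[ℝ] G} (h : IsIsometryOn Φ B B' O O')
    (hT : DifferentiableAt ℝ T' (Φ y)) (hy : y ∈ O) (a b c : E) :
    fderiv ℝ (fun z => T' (Φ z) (fderiv ℝ Φ z b) (fderiv ℝ Φ z c)) y a
      = fderiv ℝ T' (Φ y) (fderiv ℝ Φ y a) (fderiv ℝ Φ y b) (fderiv ℝ Φ y c)
        + T' (Φ y) (fderiv ℝ (fderiv ℝ Φ) y a b) (fderiv ℝ Φ y c)
        + T' (Φ y) (fderiv ℝ Φ y b) (fderiv ℝ (fderiv ℝ Φ) y a c) := by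
  have h1 : ∀ b, HasFDerivAt (fun z => fderiv ℝ Φ z b) _ y := fun b =>
    (h.hasFDerivAt_fderiv hy).clm_apply (hasFDerivAt_const b y)
  have h2 : HasFDerivAt (fun z => T' (Φ z)) _ y := hT.hasFDerivAt.comp y (h.hasFDerivAt hy)
  have h3 : HasFDerivAt (fun z => T' (Φ z) (fderiv ℝ Φ z b) (fderiv ℝ Φ z c)) _ y :=
    (h2.clm_apply (h1 b)).clm_apply (h1 c)
  rw [h3.fderiv]
  simp
  abel

theorem fderiv_metric (h : IsIsometryOn Φ B B' O O') (hy : y ∈ O) (a b c : E) :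
    fderiv ℝ B y a b c
      = fderiv ℝ B' (Φ y) (fderiv ℝ Φ y a) (fderiv ℝ Φ y b) (fderiv ℝ Φ y c)
        + B' (Φ y) (fderiv ℝ (fderiv ℝ Φ) y a b) (fderiv ℝ Φ y c)
        + B' (Φ y) (fderiv ℝ Φ y b) (fderiv ℝ (fderiv ℝ Φ) y a c) := by
  rw [← h.fderiv_pullback (h.right.differentiableAt (h.mapsTo hy)) hy,
    ← fderiv_clm_apply₂_const (h.left.differentiableAt hy)]
  exact congrArg (fun ℓ : E →L[ℝ] ℝ => ℓ a) (Filter.EventuallyEq.fderiv_eq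
    (Filter.eventuallyEq_of_mem (h.left.isOpen.mem_nhds hy) fun z hz => h.pullback z hz b c))

variable [FiniteDimensional ℝ E]

/-- A vector killed by the differential would be null for the pulled-back metric, which is definite;
in equal dimensions injectivity is enough. -/
theorem exists_equiv (h : IsIsometryOn Φ B B' O O') (hy : y ∈ O) :
    ∃ e : E ≃L[ℝ] E, (e : E →L[ℝ] E) = fderiv ℝ Φ y := by
  have hinj : Function.Injective (fderiv ℝ Φ y : E →ₗ[ℝ] E) := fun v w hvw =>
    h.left.ext hy fun c => by
      have hvw' : fderiv ℝ Φ y v = fderiv ℝ Φ y w := hvw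
      rw [h.pullback y hy, h.pullback y hy, hvw']
  refine ⟨(LinearEquiv.ofInjectiveEndo _ hinj).toContinuousLinearEquiv, ?_⟩
  ext a
  rfl

/-- To prove equality of vectors it is enough to test against vectors `DΦ c`. -/
theorem ext (h : IsIsometryOn Φ B B' O O') (hy : y ∈ O) {v w : E}
    (hvw : ∀ c, B' (Φ y) v (fderiv ℝ Φ y c) = B' (Φ y) w (fderiv ℝ Φ y c)) : v = w := by
  obtain ⟨e, he⟩ := h.exists_equiv hy
  refine h.right.ext (h.mapsTo hy) fun c => ?_
  have := hvw (e.symm c)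
  rw [← he] at this
  simpa using this

/-- Compare the two Koszul formulas. Pulling back the metric introduces six second-derivative terms
of Φ; symmetry cancels four, and the remaining two equal the inhomogeneous term D²Φ(a,b) paired with
DΦ c. -/
theorem christoffelL (h : IsIsometryOn Φ B B' O O') (hy : y ∈ O) (a b : E) :
    fderiv ℝ Φ y (christoffelL B y a b)
      = LGeom.christoffelL B' (Φ y) (fderiv ℝ Φ y a) (fderiv ℝ Φ y b)
        + fderiv ℝ (fderiv ℝ Φ) y a b := by
  refine h.ext hy fun c => ?_
  have hs := fderiv_fderiv_symm h.left.isOpen h.contDiffOn hy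
  have hB := h.right.symm _ (h.mapsTo hy)
  have h1 := h.left.apply_christoffelL hy a b c
  have h2 := h.right.apply_christoffelL (h.mapsTo hy) (fderiv ℝ Φ y a) (fderiv ℝ Φ y b)
    (fderiv ℝ Φ y c)
  rw [h.fderiv_metric hy, h.fderiv_metric hy, h.fderiv_metric hy, h.pullback y hy, hs b a, hs c a,
    hs c b, hB (fderiv ℝ Φ y a), hB _ (fderiv ℝ Φ y b)] at h1
  rw [map_add, add_apply]
  linarith

theorem fderiv_christoffelL (h : IsIsometryOn Φ B B' O O') (hy : y ∈ O) (a b c : E) :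
    fderiv ℝ Φ y (fderiv ℝ (LGeom.christoffelL B) y a b c)
        + fderiv ℝ (fderiv ℝ Φ) y a (LGeom.christoffelL B y b c)
      = fderiv ℝ (LGeom.christoffelL B') (Φ y) (fderiv ℝ Φ y a) (fderiv ℝ Φ y b) (fderiv ℝ Φ y c)
        + LGeom.christoffelL B' (Φ y) (fderiv ℝ (fderiv ℝ Φ) y a b) (fderiv ℝ Φ y c)
        + LGeom.christoffelL B' (Φ y) (fderiv ℝ Φ y b) (fderiv ℝ (fderiv ℝ Φ) y a c)
        + fderiv ℝ (fderiv ℝ (fderiv ℝ Φ)) y a b c := by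
  have hΓ := (h.left.differentiableAt_christoffelL hy).hasFDerivAt
  have hΓ' := h.right.differentiableAt_christoffelL (h.mapsTo hy)
  have h1 : HasFDerivAt (fun z => fderiv ℝ Φ z (LGeom.christoffelL B z b c)) _ y :=
    (h.hasFDerivAt_fderiv hy).clm_apply
      ((hΓ.clm_apply (hasFDerivAt_const b y)).clm_apply (hasFDerivAt_const c y))
  have hd : DifferentiableAt ℝ (fun z => LGeom.christoffelL B' (Φ z)
      (fderiv ℝ Φ z b) (fderiv ℝ Φ z c)) y := by
    have hP := (h.hasFDerivAt_fderiv hy).differentiableAt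
    have hd' : DifferentiableAt ℝ (fun z => LGeom.christoffelL B' (Φ z)) y :=
      hΓ'.comp y (h.hasFDerivAt hy).differentiableAt
    fun_prop
  have h2 : HasFDerivAt (fun z => fderiv ℝ (fderiv ℝ Φ) z b c) _ y :=
    ((h.hasFDerivAt_fderiv_fderiv hy).clm_apply (hasFDerivAt_const b y)).clm_apply
      (hasFDerivAt_const c y)
  have e : (fun z => fderiv ℝ Φ z (LGeom.christoffelL B z b c)) =ᶠ[𝓝 y] fun z =>
      LGeom.christoffelL B' (Φ z) (fderiv ℝ Φ z b) (fderiv ℝ Φ z c)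
        + fderiv ℝ (fderiv ℝ Φ) z b c :=
    Filter.eventuallyEq_of_mem (h.left.isOpen.mem_nhds hy) fun z hz => h.christoffelL hz b c
  have key := congrArg (fun ℓ : E →L[ℝ] E => ℓ a) e.fderiv_eq
  rw [(hd.hasFDerivAt.fun_add h2).fderiv, add_apply, h.fderiv_pullback hΓ' hy, h1.fderiv]
    at key
  simpa using key

/-- Each half of the curvature transforms with an error made of second and third derivatives of Φ.
That error, grouped last in `e`, is symmetric in a and b, so it drops out of the difference. -/
theorem riemannF (h : IsIsometryOn Φ B B' O O') (hy : y ∈ O) (a b c : E) :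
    fderiv ℝ Φ y (riemannF B y a b c)
      = LGeom.riemannF B' (Φ y) (fderiv ℝ Φ y a) (fderiv ℝ Φ y b) (fderiv ℝ Φ y c) := by
  have e : ∀ a b, fderiv ℝ Φ y (fderiv ℝ (LGeom.christoffelL B) y a b c
        + LGeom.christoffelL B y a (LGeom.christoffelL B y b c))
      = fderiv ℝ (LGeom.christoffelL B') (Φ y) (fderiv ℝ Φ y a) (fderiv ℝ Φ y b) (fderiv ℝ Φ y c)
        + LGeom.christoffelL B' (Φ y) (fderiv ℝ Φ y a)
            (LGeom.christoffelL B' (Φ y) (fderiv ℝ Φ y b) (fderiv ℝ Φ y c))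
        + (LGeom.christoffelL B' (Φ y) (fderiv ℝ (fderiv ℝ Φ) y a b) (fderiv ℝ Φ y c)
          + (LGeom.christoffelL B' (Φ y) (fderiv ℝ Φ y b) (fderiv ℝ (fderiv ℝ Φ) y a c)
            + LGeom.christoffelL B' (Φ y) (fderiv ℝ Φ y a) (fderiv ℝ (fderiv ℝ Φ) y b c))
          + fderiv ℝ (fderiv ℝ (fderiv ℝ Φ)) y a b c) := fun a b => by
    rw [map_add, eq_sub_of_add_eq (h.fderiv_christoffelL hy a b c), h.christoffelL hy a,
      h.christoffelL hy b, map_add]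
    abel
  have hs := fderiv_fderiv_symm h.left.isOpen h.contDiffOn hy
  have hs' := fderiv_fderiv_symm h.left.isOpen (contDiffOn_fderiv h.left.isOpen h.contDiffOn) hy
  rw [LGeom.riemannF, map_sub, e a b, e b a, hs b a, hs' b a, LGeom.riemannF]
  abel

/-- The endomorphisms a ↦ R(a,b)c on the two sides are conjugate by the differential, hence have the
same trace. -/
theorem ricciL (h : IsIsometryOn Φ B B' O O') (hy : y ∈ O) (b c : E) :
    ricciL B y b c = LGeom.ricciL B' (Φ y) (fderiv ℝ Φ y b) (fderiv ℝ Φ y c) := by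
  obtain ⟨e, he⟩ := h.exists_equiv hy
  rw [ricciL_eq_trace, ricciL_eq_trace, ← LinearMap.trace_conj' _ e.toLinearEquiv]
  congr 1
  ext a
  have := h.riemannF hy (e.symm a) b c
  rw [← he] at this ⊢
  simpa [LinearEquiv.conj_apply, riemannEnd] using this

theorem ricciEnd (h : IsIsometryOn Φ B B' O O') (hy : y ∈ O) (a : E) :
    fderiv ℝ Φ y (ricciEnd B y a) = LGeom.ricciEnd B' (Φ y) (fderiv ℝ Φ y a) := by
  refine h.ext hy fun c => ?_
  rw [h.right.inner_ricciEnd (h.mapsTo hy), ← h.ricciL hy, ← h.pullback y hy,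
    h.left.inner_ricciEnd hy]

theorem scalarCoord (h : IsIsometryOn Φ B B' O O') (hy : y ∈ O) :
    scalarCoord B y = LGeom.scalarCoord B' (Φ y) := by
  obtain ⟨e, he⟩ := h.exists_equiv hy
  rw [h.left.scalarCoord hy, h.right.scalarCoord (h.mapsTo hy),
    ← LinearMap.trace_conj' _ e.toLinearEquiv]
  congr 1
  ext a
  have := h.ricciEnd hy (e.symm a)
  rw [← he] at this
  simpa [LinearEquiv.conj_apply] using this

theorem gradCoord (h : IsIsometryOn Φ B B' O O') (hy : y ∈ O) :
    fderiv ℝ Φ y (gradCoord B (LGeom.scalarCoord B) y)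
      = LGeom.gradCoord B' (LGeom.scalarCoord B') (Φ y) := by
  refine h.ext hy fun c => ?_
  have e : LGeom.scalarCoord B =ᶠ[𝓝 y] fun z => LGeom.scalarCoord B' (Φ z) :=
    Filter.eventuallyEq_of_mem (h.left.isOpen.mem_nhds hy) fun z hz => h.scalarCoord hz
  have hs := differentiableAt_of_contDiffOn h.right.isOpen h.right.contDiffOn_scalarCoord
    (h.mapsTo hy)
  have e' : fderiv ℝ (fun z => LGeom.scalarCoord B' (Φ z)) y = _ :=
    (hs.hasFDerivAt.comp y (h.hasFDerivAt hy)).fderiv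
  rw [← h.pullback y hy, LGeom.gradCoord, LGeom.gradCoord, h.left.apply_sharp hy,
    h.right.apply_sharp (h.mapsTo hy), e.fderiv_eq, e']
  rfl

/-- The term D²Φ(u,Y) from differentiating the pushed-forward field is the one that occurs in the
transformation law of the Christoffel symbols. -/
theorem covDerivCoord (h : IsIsometryOn Φ B B' O O') (hy : y ∈ O) {Y Y' : E → E}
    (hY : DifferentiableAt ℝ Y y) (hY' : DifferentiableAt ℝ Y' (Φ y))
    (hYY : ∀ z ∈ O, fderiv ℝ Φ z (Y z) = Y' (Φ z)) (u : E) :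
    fderiv ℝ Φ y (covDerivCoord B Y y u)
      = LGeom.covDerivCoord B' Y' (Φ y) (fderiv ℝ Φ y u) := by
  have e : (fun z => fderiv ℝ Φ z (Y z)) =ᶠ[𝓝 y] fun z => Y' (Φ z) :=
    Filter.eventuallyEq_of_mem (h.left.isOpen.mem_nhds hy) hYY
  have e1 : fderiv ℝ (fun z => fderiv ℝ Φ z (Y z)) y = _ :=
    ((h.hasFDerivAt_fderiv hy).clm_apply hY.hasFDerivAt).fderiv
  have e2 : fderiv ℝ (fun z => Y' (Φ z)) y = _ :=
    (hY'.hasFDerivAt.comp y (h.hasFDerivAt hy)).fderiv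
  have key := congrArg (fun ℓ : E →L[ℝ] E => ℓ u) e.fderiv_eq
  rw [e1, e2] at key
  simp only [add_apply, ContinuousLinearMap.comp_apply, ContinuousLinearMap.flip_apply] at key
  rw [h.left.covDerivCoord hy, h.right.covDerivCoord (h.mapsTo hy), map_add, h.christoffelL hy,
    ← key, hYY y hy]
  abel

theorem covDerivCoord_grad (h : IsIsometryOn Φ B B' O O') (hy : y ∈ O) (u : E) :
    fderiv ℝ Φ y (LGeom.covDerivCoord B (LGeom.gradCoord B (LGeom.scalarCoord B)) y u)
      = LGeom.covDerivCoord B' (LGeom.gradCoord B' (LGeom.scalarCoord B')) (Φ y)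
          (fderiv ℝ Φ y u) :=
  h.covDerivCoord hy
    (differentiableAt_of_contDiffOn h.left.isOpen h.left.contDiffOn_gradCoord hy)
    (differentiableAt_of_contDiffOn h.right.isOpen h.right.contDiffOn_gradCoord (h.mapsTo hy))
    (fun _ hz => h.gradCoord hz) u

theorem nablaRicciCoord (h : IsIsometryOn Φ B B' O O') (hy : y ∈ O) (u a c : E) :
    nablaRicciCoord B y u a c
      = LGeom.nablaRicciCoord B' (Φ y) (fderiv ℝ Φ y u) (fderiv ℝ Φ y a) (fderiv ℝ Φ y c) := by
  have hr := differentiableAt_of_contDiffOn h.left.isOpen h.left.contDiffOn_ricciL hy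
  have hr' := differentiableAt_of_contDiffOn h.right.isOpen h.right.contDiffOn_ricciL
    (h.mapsTo hy)
  have e : (fun z => LGeom.ricciL B z a c) =ᶠ[𝓝 y]
      fun z => LGeom.ricciL B' (Φ z) (fderiv ℝ Φ z a) (fderiv ℝ Φ z c) :=
    Filter.eventuallyEq_of_mem (h.left.isOpen.mem_nhds hy) fun z hz => h.ricciL hz a c
  have key := congrArg (fun ℓ : E →L[ℝ] ℝ => ℓ u) e.fderiv_eq
  rw [h.fderiv_pullback hr' hy, fderiv_clm_apply₂_const hr] at key
  rw [h.left.nablaRicciCoord hy, h.right.nablaRicciCoord (h.mapsTo hy), h.ricciL hy, h.ricciL hy,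
    h.christoffelL hy, h.christoffelL hy, key]
  simp only [map_add, add_apply]
  ring

end IsIsometryOn

end Invariance

/-! ### Tensors and covariant derivatives on M read in an arbitrary chart. -/

section Charts

variable {E : Type*} [NormedAddCommGroup E] [NormedSpace ℝ E]
  {M : Type*} [TopologicalSpace M] [ChartedSpace E M] [IsManifold 𝓘(ℝ, E) ∞ M]

/-! ## Components of tangent vectors in different charts -/

theorem mem_baseSet {p q : M} (hq : q ∈ (extChartAt 𝓘(ℝ, E) p).source) :
    q ∈ (trivializationAt E (TangentSpace 𝓘(ℝ, E)) p).baseSet := by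
  rwa [TangentBundle.trivializationAt_baseSet, ← extChartAt_source 𝓘(ℝ, E)]

theorem ofCoord_toCoord {p q : M} (hq : q ∈ (extChartAt 𝓘(ℝ, E) p).source)
    (a : TangentSpace 𝓘(ℝ, E) q) : ofCoord p q (toCoord p q a) = a :=
  Bundle.Trivialization.symmL_continuousLinearMapAt _ (mem_baseSet hq) a

theorem toCoord_ofCoord {p q : M} (hq : q ∈ (extChartAt 𝓘(ℝ, E) p).source) (v : E) :
    toCoord p q (ofCoord p q v) = v :=
  Bundle.Trivialization.continuousLinearMapAt_symmL _ (mem_baseSet hq) v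

variable (E) in
/-- The change of coordinates from the chart around `p` to the chart around `p'`. -/
def transition (p p' : M) : E → E :=
  extChartAt 𝓘(ℝ, E) p' ∘ (extChartAt 𝓘(ℝ, E) p).symm

variable (E) in
/-- The domain of `transition p p'`. -/
def overlap (p p' : M) : Set E :=
  ((extChartAt 𝓘(ℝ, E) p).symm ≫ extChartAt 𝓘(ℝ, E) p').source

theorem isOpen_extChartAt_target (p : M) : IsOpen (extChartAt 𝓘(ℝ, E) p).target := by
  simpa using (chartAt E p).open_target

theorem isOpen_overlap (p p' : M) : IsOpen (overlap E p p') := by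
  have := (continuousOn_extChartAt_symm (I := 𝓘(ℝ, E)) p).isOpen_inter_preimage
    (isOpen_extChartAt_target p) (isOpen_extChartAt_source (I := 𝓘(ℝ, E)) p')
  simpa [overlap, PartialEquiv.trans_source] using this

theorem mem_overlap {p p' q : M} (hq : q ∈ (extChartAt 𝓘(ℝ, E) p).source)
    (hq' : q ∈ (extChartAt 𝓘(ℝ, E) p').source) : extChartAt 𝓘(ℝ, E) p q ∈ overlap E p p' := by
  rw [overlap, PartialEquiv.trans_source'', PartialEquiv.symm_symm, PartialEquiv.symm_target]
  exact mem_image_of_mem _ ⟨hq, hq'⟩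

theorem exists_of_mem_overlap {p p' : M} {y : E} (hy : y ∈ overlap E p p') :
    ∃ q ∈ (extChartAt 𝓘(ℝ, E) p).source, q ∈ (extChartAt 𝓘(ℝ, E) p').source ∧
      extChartAt 𝓘(ℝ, E) p q = y := by
  rw [overlap, PartialEquiv.trans_source'', PartialEquiv.symm_symm, PartialEquiv.symm_target] at hy
  obtain ⟨q, hq, rfl⟩ := hy
  exact ⟨q, hq.1, hq.2, rfl⟩

theorem transition_apply {p p' q : M} (hq : q ∈ (extChartAt 𝓘(ℝ, E) p).source) :
    transition E p p' (extChartAt 𝓘(ℝ, E) p q) = extChartAt 𝓘(ℝ, E) p' q := by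
  rw [transition, Function.comp_apply, (extChartAt 𝓘(ℝ, E) p).left_inv hq]

theorem contDiffOn_transition (p p' : M) :
    ContDiffOn ℝ ∞ (transition E p p') (overlap E p p') :=
  contDiffOn_ext_coord_change p' p

/-- Components are coordinate changes out of the chart around q, so the claim is the cocycle
identity of the tangent bundle. -/
theorem fderiv_transition {p p' q : M} (hq : q ∈ (extChartAt 𝓘(ℝ, E) p).source)
    (hq' : q ∈ (extChartAt 𝓘(ℝ, E) p').source) (a : TangentSpace 𝓘(ℝ, E) q) :
    fderiv ℝ (transition E p p') (extChartAt 𝓘(ℝ, E) p q) (toCoord p q a) = toCoord p' q a := by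
  have h1 : fderiv ℝ (transition E p p') (extChartAt 𝓘(ℝ, E) p q)
      = tangentCoordChange 𝓘(ℝ, E) p p' q := by
    rw [tangentCoordChange_def]
    simp [transition]
  have h2 : ∀ p : M, q ∈ (extChartAt 𝓘(ℝ, E) p).source →
      toCoord p q a = tangentCoordChange 𝓘(ℝ, E) q p q a := fun p hp => by
    rw [toCoord, TangentBundle.continuousLinearMapAt_trivializationAt_eq_core
      (by rwa [← extChartAt_source 𝓘(ℝ, E)])]
    rfl
  rw [h1, h2 p hq, h2 p' hq']
  exact tangentCoordChange_comp ⟨⟨mem_extChartAt_source q, hq⟩, hq'⟩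

/-! ## The metric in different charts -/

theorem metricCoord_extChartAt (h : Metric E M) {p q : M}
    (hq : q ∈ (extChartAt 𝓘(ℝ, E) p).source) (a b : TangentSpace 𝓘(ℝ, E) q) :
    metricCoord h p (extChartAt 𝓘(ℝ, E) p q) (toCoord p q a) (toCoord p q b) = h.inner q a b := by
  rw [metricCoord_apply, (extChartAt 𝓘(ℝ, E) p).left_inv hq, ofCoord_toCoord hq,
    ofCoord_toCoord hq]

theorem exists_toCoord_eq {p : M} {y : E} (hy : y ∈ (extChartAt 𝓘(ℝ, E) p).target) :
    ∃ q ∈ (extChartAt 𝓘(ℝ, E) p).source, extChartAt 𝓘(ℝ, E) p q = y ∧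
      ∀ v : E, ∃ a : TangentSpace 𝓘(ℝ, E) q, toCoord p q a = v :=
  ⟨(extChartAt 𝓘(ℝ, E) p).symm y, (extChartAt 𝓘(ℝ, E) p).map_target hy,
    (extChartAt 𝓘(ℝ, E) p).right_inv hy,
    fun v => ⟨ofCoord p _ v, toCoord_ofCoord ((extChartAt 𝓘(ℝ, E) p).map_target hy) v⟩⟩

theorem metricCoord_symm (h : Metric E M) (p : M) {y : E}
    (hy : y ∈ (extChartAt 𝓘(ℝ, E) p).target) (a b : E) :
    metricCoord h p y a b = metricCoord h p y b a := by
  obtain ⟨q, hq, rfl, hv⟩ := exists_toCoord_eq hy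
  obtain ⟨a, rfl⟩ := hv a
  obtain ⟨b, rfl⟩ := hv b
  rw [metricCoord_extChartAt h hq, metricCoord_extChartAt h hq, h.symm]

theorem metricCoord_pos (h : Metric E M) (p : M) {y : E}
    (hy : y ∈ (extChartAt 𝓘(ℝ, E) p).target) (a : E) (ha : a ≠ 0) :
    0 < metricCoord h p y a a := by
  obtain ⟨q, hq, rfl, hv⟩ := exists_toCoord_eq hy
  obtain ⟨a, rfl⟩ := hv a
  rw [metricCoord_extChartAt h hq]
  exact h.pos _ _ fun h0 => ha (by rw [h0, map_zero])

/-- The metric `h` has smooth components in all charts. -/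
def HasSmoothCoords (h : Metric E M) : Prop :=
  ∀ p : M, IsMetricOn (metricCoord h p) (extChartAt 𝓘(ℝ, E) p).target

theorem HasSmoothCoords.isIsometryOn {h : Metric E M} (hm : HasSmoothCoords h) (p p' : M) :
    IsIsometryOn (transition E p p') (metricCoord h p) (metricCoord h p') (overlap E p p')
      (extChartAt 𝓘(ℝ, E) p').target where
  left := (hm p).mono (isOpen_overlap p p') fun y hy => by
    obtain ⟨q, hq, -, rfl⟩ := exists_of_mem_overlap hy
    exact (extChartAt 𝓘(ℝ, E) p).map_source hq
  right := hm p'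
  contDiffOn := contDiffOn_transition p p'
  mapsTo y hy := by
    obtain ⟨q, hq, hq', rfl⟩ := exists_of_mem_overlap hy
    rw [transition_apply hq]
    exact (extChartAt 𝓘(ℝ, E) p').map_source hq'
  pullback y hy a b := by
    obtain ⟨q, hq, hq', rfl⟩ := exists_of_mem_overlap hy
    rw [← toCoord_ofCoord hq a, ← toCoord_ofCoord hq b, fderiv_transition hq hq',
      fderiv_transition hq hq', transition_apply hq, metricCoord_extChartAt h hq,
      metricCoord_extChartAt h hq']

variable [FiniteDimensional ℝ E] {h : Metric E M} {p q : M}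

/-- The definition uses the chart around q; the transition isometry carries the result to any chart
containing q. One fixed chart can thus serve along a piece of the curve. -/
theorem HasSmoothCoords.toCoord_riemann (hm : HasSmoothCoords h)
    (hq : q ∈ (extChartAt 𝓘(ℝ, E) p).source) (a b c : TangentSpace 𝓘(ℝ, E) q) :
    toCoord p q (riemann h a b c) = riemannF (metricCoord h p) (extChartAt 𝓘(ℝ, E) p q)
      (toCoord p q a) (toCoord p q b) (toCoord p q c) := by
  have hqq := mem_extChartAt_source (I := 𝓘(ℝ, E)) q
  rw [riemann, ← fderiv_transition hqq hq, toCoord_ofCoord hqq,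
    (hm q).riemannCoord ((extChartAt 𝓘(ℝ, E) q).map_source hqq),
    (hm.isIsometryOn q p).riemannF (mem_overlap hqq hq), fderiv_transition hqq hq,
    fderiv_transition hqq hq, fderiv_transition hqq hq, transition_apply hqq]

theorem HasSmoothCoords.ricci_eq (hm : HasSmoothCoords h)
    (hq : q ∈ (extChartAt 𝓘(ℝ, E) p).source) (a b : TangentSpace 𝓘(ℝ, E) q) :
    ricci h a b = ricciL (metricCoord h p) (extChartAt 𝓘(ℝ, E) p q)
      (toCoord p q a) (toCoord p q b) := by
  have hqq := mem_extChartAt_source (I := 𝓘(ℝ, E)) q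
  rw [ricci, (hm q).ricciCoord ((extChartAt 𝓘(ℝ, E) q).map_source hqq),
    (hm.isIsometryOn q p).ricciL (mem_overlap hqq hq), fderiv_transition hqq hq,
    fderiv_transition hqq hq, transition_apply hqq]

theorem HasSmoothCoords.nablaRicci_eq (hm : HasSmoothCoords h)
    (hq : q ∈ (extChartAt 𝓘(ℝ, E) p).source) (u a b : TangentSpace 𝓘(ℝ, E) q) :
    nablaRicci h u a b = nablaRicciCoord (metricCoord h p) (extChartAt 𝓘(ℝ, E) p q)
      (toCoord p q u) (toCoord p q a) (toCoord p q b) := by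
  have hqq := mem_extChartAt_source (I := 𝓘(ℝ, E)) q
  rw [nablaRicci, (hm.isIsometryOn q p).nablaRicciCoord (mem_overlap hqq hq),
    fderiv_transition hqq hq, fderiv_transition hqq hq, fderiv_transition hqq hq,
    transition_apply hqq]

theorem HasSmoothCoords.toCoord_covDerivGradScalar (hm : HasSmoothCoords h)
    (hq : q ∈ (extChartAt 𝓘(ℝ, E) p).source) (u : TangentSpace 𝓘(ℝ, E) q) :
    toCoord p q (covDerivGradScalar h u) = covDerivCoord (metricCoord h p)
      (gradCoord (metricCoord h p) (scalarCoord (metricCoord h p))) (extChartAt 𝓘(ℝ, E) p q)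
      (toCoord p q u) := by
  have hqq := mem_extChartAt_source (I := 𝓘(ℝ, E)) q
  rw [covDerivGradScalar, ← fderiv_transition hqq hq, toCoord_ofCoord hqq,
    (hm.isIsometryOn q p).covDerivCoord_grad (mem_overlap hqq hq), fderiv_transition hqq hq,
    transition_apply hqq]

theorem inner_ofCoord_self (a : E) (b : TangentSpace 𝓘(ℝ, E) q) :
    h.inner q (ofCoord q q a) b
      = metricCoord h q (extChartAt 𝓘(ℝ, E) q q) a (toCoord q q b) := by
  have hqq := mem_extChartAt_source (I := 𝓘(ℝ, E)) q
  rw [← metricCoord_extChartAt h hqq, toCoord_ofCoord hqq]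

theorem HasSmoothCoords.hessScalar_eq (hm : HasSmoothCoords h) (a b : TangentSpace 𝓘(ℝ, E) q) :
    hessScalar h a b = h.inner q (covDerivGradScalar h a) b := by
  rw [covDerivGradScalar, inner_ofCoord_self, hessScalar,
    (hm q).hessCoord (mem_extChartAt_target (I := 𝓘(ℝ, E)) q)]

theorem HasSmoothCoords.inner_ricciSharp (hm : HasSmoothCoords h) (a b : TangentSpace 𝓘(ℝ, E) q) :
    h.inner q (ricciSharp h a) b = ricci h a b := by
  have hq := mem_extChartAt_target (I := 𝓘(ℝ, E)) q
  rw [ricciSharp, inner_ofCoord_self, ricci, (hm q).ricciSharpCoord hq, (hm q).inner_ricciEnd hq,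
    (hm q).ricciCoord hq]

theorem HasSmoothCoords.inner_nablaRicciSharp (hm : HasSmoothCoords h)
    (u a b : TangentSpace 𝓘(ℝ, E) q) :
    h.inner q (nablaRicciSharp h u a) b = nablaRicci h u a b := by
  have hq := mem_extChartAt_target (I := 𝓘(ℝ, E)) q
  rw [nablaRicciSharp, inner_ofCoord_self, nablaRicci, (hm q).inner_nablaRicciSharpCoord hq]

/-- Skewness in each pair of slots, applied once each. This matches ⟨R(X,U)X, V⟩ in the Jacobi
operator with ⟨R(U,X)V, X⟩ in the index form. -/
theorem HasSmoothCoords.inner_riemann (hm : HasSmoothCoords h)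
    (a b c d : TangentSpace 𝓘(ℝ, E) q) :
    h.inner q (riemann h a b c) d = h.inner q (riemann h b a d) c := by
  have hq := mem_extChartAt_target (I := 𝓘(ℝ, E)) q
  rw [riemann, riemann, inner_ofCoord_self, inner_ofCoord_self, (hm q).riemannCoord hq,
    (hm q).riemannCoord hq, (hm q).riemannF_skew hq, riemannF_antisymm]
  simp

/-! ## Curves in different charts -/

section Curves

variable {γ : ℝ → M} {s : Set ℝ} {τ : ℝ}

theorem hasDerivWithinAt_extChartAt (hγ : MDifferentiableWithinAt 𝓘(ℝ, ℝ) 𝓘(ℝ, E) γ s τ)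
    (hp : γ τ ∈ (extChartAt 𝓘(ℝ, E) p).source) :
    HasDerivWithinAt (fun t => extChartAt 𝓘(ℝ, E) p (γ t)) (toCoord p (γ τ) (velocity γ s τ))
      s τ := by
  have hp' : γ τ ∈ (chartAt E p).source := by rwa [← extChartAt_source 𝓘(ℝ, E)]
  have h1 := (mdifferentiableAt_extChartAt (I := 𝓘(ℝ, E)) hp').hasMFDerivAt.comp_hasMFDerivWithinAt
    τ hγ.hasMFDerivWithinAt
  have h2 : HasFDerivWithinAt (fun t => extChartAt 𝓘(ℝ, E) p (γ t))
      ((toCoord p (γ τ)).comp (mfderivWithin 𝓘(ℝ, ℝ) 𝓘(ℝ, E) γ s τ) : ℝ →L[ℝ] E) s τ := by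
    rw [toCoord, TangentBundle.continuousLinearMapAt_trivializationAt hp']
    exact h1.hasFDerivWithinAt
  exact h2.hasDerivWithinAt

theorem eventually_mem_source (hγ : ContinuousWithinAt γ s τ)
    (hp : γ τ ∈ (extChartAt 𝓘(ℝ, E) p).source) :
    ∀ᶠ t in 𝓝[s] τ, γ t ∈ (extChartAt 𝓘(ℝ, E) p).source :=
  hγ.eventually ((isOpen_extChartAt_source (I := 𝓘(ℝ, E)) p).mem_nhds hp)

theorem hasDerivWithinAt_toCoord {W : ∀ t, TangentSpace 𝓘(ℝ, E) (γ t)} {w' : E} {q : M}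
    (hγ : MDifferentiableWithinAt 𝓘(ℝ, ℝ) 𝓘(ℝ, E) γ s τ)
    (hp : γ τ ∈ (extChartAt 𝓘(ℝ, E) p).source) (hq : γ τ ∈ (extChartAt 𝓘(ℝ, E) q).source)
    (hW : HasDerivWithinAt (fun t => toCoord p (γ t) (W t)) w' s τ) :
    HasDerivWithinAt (fun t => toCoord q (γ t) (W t))
      (fderiv ℝ (fderiv ℝ (transition E p q)) (extChartAt 𝓘(ℝ, E) p (γ τ))
          (toCoord p (γ τ) (velocity γ s τ)) (toCoord p (γ τ) (W τ))
        + fderiv ℝ (transition E p q) (extChartAt 𝓘(ℝ, E) p (γ τ)) w') s τ := by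
  have ho := isOpen_overlap (E := E) p q
  have h1 : HasFDerivAt (fderiv ℝ (transition E p q))
      (fderiv ℝ (fderiv ℝ (transition E p q)) (extChartAt 𝓘(ℝ, E) p (γ τ)))
      (extChartAt 𝓘(ℝ, E) p (γ τ)) :=
    (differentiableAt_of_contDiffOn ho (contDiffOn_fderiv ho (contDiffOn_transition p q))
      (mem_overlap hp hq)).hasFDerivAt
  have h2 : HasDerivWithinAt (fun t => fderiv ℝ (transition E p q) (extChartAt 𝓘(ℝ, E) p (γ t)))
      (fderiv ℝ (fderiv ℝ (transition E p q)) (extChartAt 𝓘(ℝ, E) p (γ τ))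
        (toCoord p (γ τ) (velocity γ s τ))) s τ :=
    h1.comp_hasDerivWithinAt τ (hasDerivWithinAt_extChartAt hγ hp)
  refine (h2.clm_apply hW).congr_of_eventuallyEq ?_ (fderiv_transition hp hq _).symm
  filter_upwards [eventually_mem_source hγ.continuousWithinAt hp,
    eventually_mem_source hγ.continuousWithinAt hq] with t hpt hqt
  exact (fderiv_transition hpt hqt _).symm

theorem HasSmoothCoords.toCoord_covDerivAlong (hm : HasSmoothCoords h)
    {W : ∀ t, TangentSpace 𝓘(ℝ, E) (γ t)} {w' : E}
    (hs : UniqueDiffWithinAt ℝ s τ)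
    (hγ : MDifferentiableWithinAt 𝓘(ℝ, ℝ) 𝓘(ℝ, E) γ s τ)
    (hp : γ τ ∈ (extChartAt 𝓘(ℝ, E) p).source)
    (hW : HasDerivWithinAt (fun t => toCoord p (γ t) (W t)) w' s τ) :
    toCoord p (γ τ) (covDerivAlong h γ s W τ)
      = w' + christoffelL (metricCoord h p) (extChartAt 𝓘(ℝ, E) p (γ τ))
          (toCoord p (γ τ) (velocity γ s τ)) (toCoord p (γ τ) (W τ)) := by
  have hqq := mem_extChartAt_source (I := 𝓘(ℝ, E)) (γ τ)
  have h1 := hasDerivWithinAt_toCoord hγ hp hqq hW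
  have h2 := hasDerivWithinAt_toCoord hγ hqq hp h1
  -- Passing from the chart p to the one around γ τ and back must return w'. This uniqueness
  -- replaces a computation with the inverse of the transition map.
  have h3 := hs.eq_deriv _ h2 hW
  rw [covDerivAlong, ← fderiv_transition hqq hp, toCoord_ofCoord hqq, h1.derivWithin hs, map_add,
    (hm (γ τ)).christoffel (mem_extChartAt_target (I := 𝓘(ℝ, E)) (γ τ)),
    (hm.isIsometryOn (γ τ) p).christoffelL (mem_overlap hqq hp), fderiv_transition hqq hp,
    fderiv_transition hqq hp, transition_apply hqq]
  conv_rhs => rw [← h3]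
  abel

end Curves

end Charts

/-! ### Time derivatives of the metric and of its connection under the flow. -/

section Flow

variable {E : Type*} [NormedAddCommGroup E] [NormedSpace ℝ E]
  {G : Type*} [NormedAddCommGroup G] [NormedSpace ℝ G]

/-! ## The backwards Ricci flow in coordinates -/

theorem SmoothFamily.contDiffAt {F : ℝ → E → G} {I : Set ℝ} {O : Set E} (hF : SmoothFamily F I O)
    (hO : IsOpen O) {τ : ℝ} (hτ : I ∈ 𝓝 τ) {y : E} (hy : y ∈ O) :
    ContDiffAt ℝ ∞ (fun z : ℝ × E => F z.1 z.2) (τ, y) :=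
  ContDiffOn.contDiffAt hF (prod_mem_nhds hτ (hO.mem_nhds hy))

theorem hasDerivAt_comp_pair {f : ℝ × E → G} {L : ℝ × E →L[ℝ] G} {c : ℝ → E} {X : E} {τ : ℝ}
    (hf : HasFDerivAt f L (τ, c τ)) (hc : HasDerivAt c X τ) :
    HasDerivAt (fun t => f (t, c t)) (L (1, X)) τ := by
  have hp : HasDerivAt (fun t => (t, c t)) (1, X) τ := (hasDerivAt_id' τ).prodMk hc
  exact HasFDerivAt.comp_hasDerivAt (f := fun t => (t, c t)) τ hf hp

/-- The total derivative of a smooth family along a curve. -/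
theorem SmoothFamily.hasDerivAt_curve {F : ℝ → E → G} {I : Set ℝ} {O : Set E}
    (hF : SmoothFamily F I O) (hO : IsOpen O) {τ : ℝ} (hτ : I ∈ 𝓝 τ) {c : ℝ → E} {X : E}
    (hc : HasDerivAt c X τ) (hy : c τ ∈ O) {Ft : G}
    (hFt : HasDerivAt (fun t => F t (c τ)) Ft τ) :
    HasDerivAt (fun t => F t (c t)) (Ft + fderiv ℝ (F τ) (c τ) X) τ := by
  have hd := ((hF.contDiffAt hO hτ hy).differentiableAt (by simp)).hasFDerivAt
  set L := fderiv ℝ (fun z : ℝ × E => F z.1 z.2) (τ, c τ)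
  have h1 : HasDerivAt (fun t => F t (c τ)) (L (1, 0)) τ :=
    hasDerivAt_comp_pair (c := fun _ => c τ) hd (hasDerivAt_const τ (c τ))
  have h2 : HasFDerivAt (F τ) (L.comp (ContinuousLinearMap.inr ℝ ℝ E)) (c τ) :=
    HasFDerivAt.comp (c τ) hd (hasFDerivAt_prodMk_right τ (c τ))
  have h3 : HasDerivAt (fun t => F t (c t)) (L (1, X)) τ :=
    hasDerivAt_comp_pair hd hc
  rw [hFt.unique h1, h2.fderiv]
  refine h3.congr_deriv ?_
  rw [ContinuousLinearMap.comp_apply, ← map_add]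
  simp

theorem SmoothFamily.differentiableAt_time {F : ℝ → E → G} {I : Set ℝ} {O : Set E}
    (hF : SmoothFamily F I O) (hO : IsOpen O) {τ : ℝ} (hτ : I ∈ 𝓝 τ) {y : E} (hy : y ∈ O) :
    DifferentiableAt ℝ (fun t => F t y) τ := by
  have hd := (hF.contDiffAt hO hτ hy).differentiableAt (by simp)
  exact (hd.hasFDerivAt.comp_hasDerivAt τ
    ((hasDerivAt_id τ).prodMk (hasDerivAt_const τ y))).differentiableAt

/-- The time derivative commutes with the space derivative. -/
theorem SmoothFamily.hasDerivAt_fderiv {F F' : ℝ → E → G} {I : Set ℝ} {O : Set E}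
    (hF : SmoothFamily F I O) (hO : IsOpen O) {τ : ℝ} (hτ : I ∈ 𝓝 τ) {y : E} (hy : y ∈ O)
    (hF' : ∀ z ∈ O, HasDerivAt (fun t => F t z) (F' τ z) τ) :
    HasDerivAt (fun t => fderiv ℝ (F t) y) (fderiv ℝ (F' τ) y) τ := by
  set f : ℝ × E → G := fun z => F z.1 z.2 with hf
  have hcd := hF.contDiffAt hO hτ hy
  have hcd' : ContDiffAt ℝ ∞ (fderiv ℝ f) (τ, y) := hcd.fderiv_right (by simp)
  have hd2 := (hcd'.differentiableAt (by simp)).hasFDerivAt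
  set f2 := fderiv ℝ (fderiv ℝ f) (τ, y)
  -- Symmetry of the second derivative on ℝ × E is what exchanges the time and space derivatives.
  have hsym : ∀ a b, f2 a b = f2 b a := fun a b =>
    (hcd.isSymmSndFDerivAt (by simpa using WithTop.coe_le_coe.2 (le_top : (2 : ℕ∞) ≤ ⊤))) a b
  have hFd : ∀ᶠ z in 𝓝 y, fderiv ℝ f (τ, z) (1, 0) = F' τ z := by
    filter_upwards [hO.mem_nhds hy] with z hz
    have h1 := ((hF.contDiffAt hO hτ hz).differentiableAt (by simp)).hasFDerivAt
    have h2 : HasDerivAt (fun t => F t z) _ τ :=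
      hasDerivAt_comp_pair (c := fun _ => z) h1 (hasDerivAt_const τ z)
    exact h2.unique (hF' z hz)
  have h1 : HasFDerivAt (F' τ) ((ContinuousLinearMap.apply ℝ G ((1, 0) : ℝ × E)).comp
      (f2.comp (ContinuousLinearMap.inr ℝ ℝ E))) y := by
    refine HasFDerivAt.congr_of_eventuallyEq (f := fun z => fderiv ℝ f (τ, z) (1, 0)) ?_
      (hFd.mono fun z hz => hz.symm)
    exact (ContinuousLinearMap.apply ℝ G ((1, 0) : ℝ × E)).hasFDerivAt.comp y
      (HasFDerivAt.comp y hd2 (hasFDerivAt_prodMk_right τ y))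
  have h2 : ∀ᶠ t in 𝓝 τ, fderiv ℝ (F t) y
      = (fderiv ℝ f (t, y)).comp (ContinuousLinearMap.inr ℝ ℝ E) := by
    filter_upwards [eventually_mem_nhds_iff.2 hτ] with t ht
    have h1 := ((hF.contDiffAt hO ht hy).differentiableAt (by simp)).hasFDerivAt
    exact (HasFDerivAt.comp y h1 (hasFDerivAt_prodMk_right t y)).fderiv
  have h3 : HasDerivAt (fun t => fderiv ℝ f (t, y)) (f2 (1, 0)) τ :=
    hd2.comp_hasDerivAt τ ((hasDerivAt_id τ).prodMk (hasDerivAt_const τ y))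
  have h4 := (((ContinuousLinearMap.compL ℝ E (ℝ × E) G).flip
    (ContinuousLinearMap.inr ℝ ℝ E)).hasFDerivAt.comp_hasDerivAt τ h3).congr_of_eventuallyEq h2
  rw [h1.fderiv]
  convert! h4 using 1
  ext w
  simp [hsym (1, 0)]

variable [FiniteDimensional ℝ E]

/-- `B` solves the backwards Ricci flow equation in coordinates. -/
structure IsFlowFamily (B : ℝ → E → E →L[ℝ] E →L[ℝ] ℝ) (I : Set ℝ) (O : Set E) : Prop
    extends IsMetricFamily B I O where
  uniqueDiffOn : UniqueDiffOn ℝ I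
  flow : ∀ t ∈ I, ∀ y ∈ O, ∀ a b,
    HasDerivWithinAt (fun t => B t y a b) (2 * ricciL (B t) y a b) I t

variable {B : ℝ → E → E →L[ℝ] E →L[ℝ] ℝ} {I : Set ℝ} {O : Set E} {τ : ℝ} {y : E}

namespace IsFlowFamily

/-- By the flow equation Ric is half the time derivative of a symmetric form. Uniqueness of
derivatives within `I` covers the end times too, and the Bianchi identity is not needed. -/
theorem ricciL_symm (h : IsFlowFamily B I O) (hτ : τ ∈ I) (hy : y ∈ O) (a b : E) :
    ricciL (B τ) y a b = ricciL (B τ) y b a := by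
  have h1 := (h.flow τ hτ y hy a b).congr (f₁ := fun t => B t y b a)
    (fun t ht => h.symm t ht y hy b a) (h.symm τ hτ y hy b a)
  have := (h.uniqueDiffOn τ hτ).eq_deriv _ h1 (h.flow τ hτ y hy b a)
  linarith

theorem fderiv_ricciL_symm (h : IsFlowFamily B I O) (hτ : τ ∈ I) (hy : y ∈ O) (u a b : E) :
    fderiv ℝ (ricciL (B τ)) y u a b = fderiv ℝ (ricciL (B τ)) y u b a := by
  have hm := h.slice hτ
  have hr := differentiableAt_of_contDiffOn hm.isOpen hm.contDiffOn_ricciL hy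
  have e : (fun z => ricciL (B τ) z a b) =ᶠ[𝓝 y] fun z => ricciL (B τ) z b a :=
    Filter.eventuallyEq_of_mem (h.isOpen.mem_nhds hy) fun z hz => h.ricciL_symm hτ hz a b
  rw [← fderiv_clm_apply₂_const hr, ← fderiv_clm_apply₂_const hr, e.fderiv_eq]

theorem nablaRicciCoord_symm (h : IsFlowFamily B I O) (hτ : τ ∈ I) (hy : y ∈ O) (u a b : E) :
    nablaRicciCoord (B τ) y u a b = nablaRicciCoord (B τ) y u b a := by
  rw [(h.slice hτ).nablaRicciCoord hy, (h.slice hτ).nablaRicciCoord hy,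
    h.fderiv_ricciL_symm hτ hy, h.ricciL_symm hτ hy a, h.ricciL_symm hτ hy _ b]
  ring

theorem hasDerivAt (h : IsFlowFamily B I O) (hτ : I ∈ 𝓝 τ) (hy : y ∈ O) :
    HasDerivAt (fun t => B t y) ((2 : ℝ) • ricciL (B τ) y) τ := by
  have h1 := (h.smooth.differentiableAt_time h.isOpen hτ hy).hasDerivAt
  refine h1.congr_deriv (ContinuousLinearMap.ext fun a => ContinuousLinearMap.ext fun b => ?_)
  have h2 : HasDerivAt (fun t => B t y a b) _ τ :=
    (h1.clm_apply (hasDerivAt_const τ a)).clm_apply (hasDerivAt_const τ b)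
  have h3 := ((h.flow τ (mem_of_mem_nhds hτ) y hy a b).hasDerivAt hτ).unique h2
  simpa using h3.symm

theorem hasDerivAt_fderiv (h : IsFlowFamily B I O) (hτ : I ∈ 𝓝 τ) (hy : y ∈ O) :
    HasDerivAt (fun t => fderiv ℝ (B t) y) ((2 : ℝ) • fderiv ℝ (ricciL (B τ)) y) τ := by
  have hm := h.slice (mem_of_mem_nhds hτ)
  have hr := differentiableAt_of_contDiffOn hm.isOpen hm.contDiffOn_ricciL hy
  have := h.smooth.hasDerivAt_fderiv (F' := fun t z => (2 : ℝ) • ricciL (B t) z) h.isOpen hτ hy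
    fun z hz => h.hasDerivAt hτ hz
  rwa [fderiv_fun_const_smul hr] at this

/-- The variation of the Levi-Civita connection under the backwards Ricci flow. -/
theorem inner_deriv_christoffelL (h : IsFlowFamily B I O) (hτ : I ∈ 𝓝 τ) (hy : y ∈ O)
    {Γ' : E →L[ℝ] E →L[ℝ] E} (hΓ : HasDerivAt (fun t => christoffelL (B t) y) Γ' τ) (a b c : E) :
    B τ y (Γ' a b) c = nablaRicciCoord (B τ) y a b c + nablaRicciCoord (B τ) y b a c
      - nablaRicciCoord (B τ) y c a b := by
  have hI := mem_of_mem_nhds hτ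
  have hm := h.slice hI
  have h1 := ((h.hasDerivAt hτ hy).clm_apply
    ((hΓ.clm_apply (hasDerivAt_const τ a)).clm_apply (hasDerivAt_const τ b))).clm_apply
    (hasDerivAt_const τ c) |>.const_mul 2
  have hD : ∀ a b c, HasDerivAt (fun t => fderiv ℝ (B t) y a b c)
      (2 * fderiv ℝ (ricciL (B τ)) y a b c) τ := fun a b c => by
    have := (((h.hasDerivAt_fderiv hτ hy).clm_apply (hasDerivAt_const τ a)).clm_apply
      (hasDerivAt_const τ b)).clm_apply (hasDerivAt_const τ c)
    simpa using this
  have h2 := ((hD a b c).fun_add (hD b a c)).fun_sub (hD c a b)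
  -- The Koszul formula is differentiated in time. The derivative of the metric on its left side
  -- supplies the Christoffel corrections that turn partial derivatives of Ric into covariant ones.
  have e : (fun t => 2 * B t y (christoffelL (B t) y a b) c) =ᶠ[𝓝 τ]
      fun t => fderiv ℝ (B t) y a b c + fderiv ℝ (B t) y b a c - fderiv ℝ (B t) y c a b :=
    Filter.eventuallyEq_of_mem hτ fun t ht => (h.slice ht).apply_christoffelL hy a b c
  have h3 := h1.unique (h2.congr_of_eventuallyEq e)
  simp only [map_zero, add_zero, add_apply, smul_apply, smul_eq_mul] at h3
  have hs := h.ricciL_symm hI hy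
  rw [hm.nablaRicciCoord hy, hm.nablaRicciCoord hy, hm.nablaRicciCoord hy,
    hm.christoffelL_symm hy b a, hm.christoffelL_symm hy c a, hm.christoffelL_symm hy c b,
    hs b, hs a (christoffelL (B τ) y b c), hs (christoffelL (B τ) y a c) b]
  linarith [hs b (christoffelL (B τ) y a c)]

/-- The derivative of `2 √t ⟨∇_X u, v⟩` along a curve `c` with velocity `X`; here `W` is
`∇_X u` with respect to the connection frozen at the time `τ`. -/
theorem hasDerivAt_boundary (h : IsFlowFamily B I O) (hτ : I ∈ 𝓝 τ) (hτ0 : 0 < τ)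
    {c X u u' v : ℝ → E} {X' u'' v' W' : E} (hc : HasDerivAt c (X τ) τ) (hy : c τ ∈ O)
    (hX : HasDerivAt X X' τ) (hu : HasDerivAt u (u' τ) τ) (hu' : HasDerivAt u' u'' τ)
    (hv : HasDerivAt v v' τ)
    (hW : HasDerivAt (fun t => u' t + christoffelL (B τ) (c t) (X t) (u t)) W' τ) :
    HasDerivAt (fun t => 2 * √t * B t (c t) (u' t + christoffelL (B t) (c t) (X t) (u t)) (v t))
      (√τ * (1 / τ * B τ (c τ) (u' τ + christoffelL (B τ) (c τ) (X τ) (u τ)) (v τ)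
        + 4 * ricciL (B τ) (c τ) (u' τ + christoffelL (B τ) (c τ) (X τ) (u τ)) (v τ)
        + 2 * B τ (c τ) (W' + christoffelL (B τ) (c τ) (X τ)
            (u' τ + christoffelL (B τ) (c τ) (X τ) (u τ))) (v τ)
        + 2 * (nablaRicciCoord (B τ) (c τ) (X τ) (u τ) (v τ)
            + nablaRicciCoord (B τ) (c τ) (u τ) (X τ) (v τ)
            - nablaRicciCoord (B τ) (c τ) (v τ) (X τ) (u τ))
        + 2 * B τ (c τ) (u' τ + christoffelL (B τ) (c τ) (X τ) (u τ))
            (v' + christoffelL (B τ) (c τ) (X τ) (v τ)))) τ := by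
  have hm := h.slice (mem_of_mem_nhds hτ)
  have hΓt := (h.smooth_christoffelL.differentiableAt_time h.isOpen hτ hy).hasDerivAt
  set Γt := deriv (fun t => christoffelL (B t) (c τ)) τ
  have hB := SmoothFamily.hasDerivAt_curve h.smooth h.isOpen hτ hc hy (h.hasDerivAt hτ hy)
  have hΓ := SmoothFamily.hasDerivAt_curve h.smooth_christoffelL h.isOpen hτ hc hy hΓt
  have hΓτ : HasDerivAt (fun t => christoffelL (B τ) (c t)) _ τ :=
    (hm.differentiableAt_christoffelL hy).hasFDerivAt.comp_hasDerivAt τ hc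
  have hA := hu'.fun_add ((hΓ.clm_apply hX).clm_apply hu)
  -- With the connection frozen only its space derivative enters. The derivative in `hA` exceeds
  -- this one by Γt(X,u), which `hG` expresses through ∇Ric.
  have hWW := hW.unique (hu'.fun_add ((hΓτ.clm_apply hX).clm_apply hu))
  have hs : HasDerivAt (fun t : ℝ => 2 * √t) (√τ * (1 / τ)) τ := by
    refine ((Real.hasDerivAt_sqrt hτ0.ne').const_mul 2).congr_deriv ?_
    have : √τ * √τ = τ := Real.mul_self_sqrt hτ0.le
    have h0 : √τ ≠ 0 := (Real.sqrt_pos.2 hτ0).ne'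
    field_simp
    linarith
  have key := hs.fun_mul ((hB.clm_apply hA).clm_apply hv)
  refine key.congr_deriv ?_
  have hG := h.inner_deriv_christoffelL hτ hy hΓt (X τ) (u τ) (v τ)
  rw [hWW]
  simp only [add_apply, smul_apply, smul_eq_mul, map_add, hm.compat hy] at hG ⊢
  linear_combination 2 * √τ * hG
end IsFlowFamily

end Flow

/-! ### The derivative of the boundary term on the manifold. -/

section Derivative

variable {E : Type*} [NormedAddCommGroup E] [NormedSpace ℝ E]
  {M : Type*} [TopologicalSpace M] [ChartedSpace E M] [IsManifold 𝓘(ℝ, E) ∞ M]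
  [FiniteDimensional ℝ E] {g : ℝ → Metric E M} {τ₁ τ₂ τ : ℝ} {p q : M}

/-! ## The backwards Ricci flow in charts -/

theorem IsBackwardsRicciFlow.isMetricFamily (hg : IsBackwardsRicciFlow g τ₁ τ₂) (p : M) :
    IsMetricFamily (fun t => metricCoord (g t) p) (Icc τ₁ τ₂) (extChartAt 𝓘(ℝ, E) p).target :=
  ⟨isOpen_extChartAt_target p, hg.smooth p, fun t _ _ hy => metricCoord_symm (g t) p hy,
    fun t _ _ hy => metricCoord_pos (g t) p hy⟩

theorem IsBackwardsRicciFlow.hasSmoothCoords (hg : IsBackwardsRicciFlow g τ₁ τ₂)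
    (hτ : τ ∈ Icc τ₁ τ₂) : HasSmoothCoords (g τ) :=
  fun p => (hg.isMetricFamily p).slice hτ

theorem IsBackwardsRicciFlow.isFlowFamily (hg : IsBackwardsRicciFlow g τ₁ τ₂) (hτ : τ₁ < τ₂)
    (p : M) : IsFlowFamily (fun t => metricCoord (g t) p) (Icc τ₁ τ₂)
      (extChartAt 𝓘(ℝ, E) p).target where
  toIsMetricFamily := hg.isMetricFamily p
  uniqueDiffOn := uniqueDiffOn_Icc hτ
  flow t ht y hy a b := by
    obtain ⟨q, hq, rfl, hv⟩ := exists_toCoord_eq hy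
    obtain ⟨a, rfl⟩ := hv a
    obtain ⟨b, rfl⟩ := hv b
    simp only [metricCoord_extChartAt _ hq]
    rw [← (hg.hasSmoothCoords ht).ricci_eq hq]
    exact hg.flow t ht q a b

theorem IsBackwardsRicciFlow.nablaRicci_symm (hg : IsBackwardsRicciFlow g τ₁ τ₂) (hτ : τ₁ < τ₂)
    (ht : τ ∈ Icc τ₁ τ₂) (u a b : TangentSpace 𝓘(ℝ, E) q) :
    nablaRicci (g τ) u a b = nablaRicci (g τ) u b a :=
  (hg.isFlowFamily hτ q).nablaRicciCoord_symm ht (mem_extChartAt_target (I := 𝓘(ℝ, E)) q) _ _ _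

variable {γ : ℝ → M} {s : Set ℝ} {U V : ∀ t, TangentSpace 𝓘(ℝ, E) (γ t)}

/-- The pointwise identity behind the integration by parts. -/
theorem IsBackwardsRicciFlow.index_add_jacobi (hg : IsBackwardsRicciFlow g τ₁ τ₂) (hτ : τ₁ < τ₂)
    (ht : τ ∈ Icc τ₁ τ₂) :
    indexIntegrand g γ s U V τ + 2 * jacobiIntegrand g γ s U V τ
      = √τ * (1 / τ * (g τ).inner (γ τ) (nablaX g γ s U τ) (V τ)
        + 4 * ricci (g τ) (nablaX g γ s U τ) (V τ)
        + 2 * (g τ).inner (γ τ) (nablaXX g γ s U τ) (V τ)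
        + 2 * (nablaRicci (g τ) (velocity γ s τ) (U τ) (V τ)
            + nablaRicci (g τ) (U τ) (velocity γ s τ) (V τ)
            - nablaRicci (g τ) (V τ) (velocity γ s τ) (U τ))
        + 2 * (g τ).inner (γ τ) (nablaX g γ s U τ) (nablaX g γ s V τ)) := by
  have hm := hg.hasSmoothCoords ht
  have e1 : (g τ).inner (γ τ) (jacobiOperator g γ s U τ) (V τ)
      = (g τ).inner (γ τ) (nablaXX g γ s U τ) (V τ)
        - (g τ).inner (γ τ) (riemann (g τ) (U τ) (velocity γ s τ) (V τ)) (velocity γ s τ)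
        - 1 / 2 * hessScalar (g τ) (U τ) (V τ)
        + 2 * nablaRicci (g τ) (U τ) (velocity γ s τ) (V τ)
        + 2 * ricci (g τ) (nablaX g γ s U τ) (V τ)
        + 1 / (2 * τ) * (g τ).inner (γ τ) (nablaX g γ s U τ) (V τ) := by
    rw [jacobiOperator, hm.inner_riemann (U τ), hm.hessScalar_eq, ← hm.inner_nablaRicciSharp,
      ← hm.inner_ricciSharp]
    simp only [map_add, map_sub, map_smul, add_apply, sub_apply, smul_apply, smul_eq_mul]
  -- Once the slots are aligned, the coefficient -2 of (∇_U Ric)(X,V) in I meets +4 from 2J and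
  -- leaves +2.
  rw [indexIntegrand, jacobiIntegrand, e1, hg.nablaRicci_symm hτ ht (U τ) (V τ),
    hg.nablaRicci_symm hτ ht (V τ) (U τ)]
  rw [show 1 / (2 * τ) = 1 / 2 * (1 / τ) by rw [one_div_mul_one_div]]
  ring

/-- The derivative of `2 √τ ⟨∇_X U, V⟩`. -/
theorem IsBackwardsRicciFlow.hasDerivAt_boundaryTerm (hg : IsBackwardsRicciFlow g τ₁ τ₂)
    (hτ : τ ∈ Ioo τ₁ τ₂) (hτ0 : 0 < τ)
    (hγ : ∀ᶠ t in 𝓝 τ, MDifferentiableWithinAt 𝓘(ℝ, ℝ) 𝓘(ℝ, E) γ (Icc τ₁ τ₂) t)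
    (hp : γ τ ∈ (extChartAt 𝓘(ℝ, E) p).source)
    (hc : ContDiffAt ℝ ∞ (fun t => extChartAt 𝓘(ℝ, E) p (γ t)) τ)
    (hU : ContDiffAt ℝ ∞ (fun t => toCoord p (γ t) (U t)) τ)
    (hV : DifferentiableAt ℝ (fun t => toCoord p (γ t) (V t)) τ) :
    HasDerivAt (boundaryTerm g γ (Icc τ₁ τ₂) U V)
      (indexIntegrand g γ (Icc τ₁ τ₂) U V τ + 2 * jacobiIntegrand g γ (Icc τ₁ τ₂) U V τ) τ := by
  have h12 : τ₁ < τ₂ := hτ.1.trans hτ.2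
  have hI : Icc τ₁ τ₂ ∈ 𝓝 τ := Icc_mem_nhds hτ.1 hτ.2
  have hτI := Ioo_subset_Icc_self hτ
  have huniq := uniqueDiffOn_Icc h12
  have hIe : ∀ᶠ t in 𝓝 τ, Icc τ₁ τ₂ ∈ 𝓝 t := eventually_mem_nhds_iff.2 hI
  have hpe : ∀ᶠ t in 𝓝 τ, γ t ∈ (extChartAt 𝓘(ℝ, E) p).source := by
    have := eventually_mem_source hγ.self_of_nhds.continuousWithinAt hp
    rwa [nhdsWithin_eq_nhds.2 hI] at this
  have hf := hg.isFlowFamily h12 p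
  set c : ℝ → E := fun t => extChartAt 𝓘(ℝ, E) p (γ t) with hcdef
  set u : ℝ → E := fun t => toCoord p (γ t) (U t) with hudef
  set v : ℝ → E := fun t => toCoord p (γ t) (V t) with hvdef
  set X : ℝ → E := fun t => toCoord p (γ t) (velocity γ (Icc τ₁ τ₂) t) with hXdef
  have hcX : ∀ᶠ t in 𝓝 τ, HasDerivAt c (X t) t := by
    filter_upwards [hγ, hpe, hIe] with t h1 h2 h3
    exact (hasDerivWithinAt_extChartAt h1 h2).hasDerivAt h3
  have hue : ∀ᶠ t in 𝓝 τ, HasDerivAt u (deriv u t) t := by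
    filter_upwards [(hU.of_le (m := 1) (by simp)).eventually (by simp)] with t h1
    exact (h1.differentiableAt one_ne_zero).hasDerivAt
  have hX : HasDerivAt X (deriv (deriv c) τ) τ := by
    have h1 : ContDiffAt ℝ ∞ (deriv c) τ := by
      have := hc.fderiv_right (m := ∞) (by simp)
      exact this.clm_apply (contDiffAt_const (c := (1 : ℝ)))
    refine (h1.differentiableAt (by simp)).hasDerivAt.congr_of_eventuallyEq ?_
    exact hcX.mono fun t ht => ht.deriv.symm
  have hu' : HasDerivAt (deriv u) (deriv (deriv u) τ) τ := by
    have h1 : ContDiffAt ℝ ∞ (deriv u) τ := by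
      have := hU.fderiv_right (m := ∞) (by simp)
      exact this.clm_apply (contDiffAt_const (c := (1 : ℝ)))
    exact (h1.differentiableAt (by simp)).hasDerivAt
  have hcτ : c τ ∈ (extChartAt 𝓘(ℝ, E) p).target := (extChartAt 𝓘(ℝ, E) p).map_source hp
  -- Here the metric stays at time r while t varies, as in `nablaXX`; in `hnX` it moves with t, as
  -- in the boundary term.
  have hcov : ∀ r ∈ Icc τ₁ τ₂, ∀ᶠ t in 𝓝 τ, toCoord p (γ t) (covDerivAlong (g r) γ (Icc τ₁ τ₂) U t)
      = deriv u t + christoffelL (metricCoord (g r) p) (c t) (X t) (u t) := by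
    intro r hr
    filter_upwards [hγ, hpe, hIe, hue] with t h1 h2 h3 h4
    exact (hg.hasSmoothCoords hr).toCoord_covDerivAlong (huniq t (mem_of_mem_nhds h3)) h1 h2
      h4.hasDerivWithinAt
  have hnX : ∀ᶠ t in 𝓝 τ, toCoord p (γ t) (nablaX g γ (Icc τ₁ τ₂) U t)
      = deriv u t + christoffelL (metricCoord (g t) p) (c t) (X t) (u t) := by
    filter_upwards [hγ, hpe, hIe, hue] with t h1 h2 h3 h4
    exact (hg.hasSmoothCoords (mem_of_mem_nhds h3)).toCoord_covDerivAlong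
      (huniq t (mem_of_mem_nhds h3)) h1 h2 h4.hasDerivWithinAt
  have hΓτ := ((hf.slice hτI).differentiableAt_christoffelL hcτ).hasFDerivAt.comp_hasDerivAt τ
    hcX.self_of_nhds
  have hW : HasDerivAt (fun t => deriv u t + christoffelL (metricCoord (g τ) p) (c t) (X t) (u t))
    _ τ := hu'.fun_add ((hΓτ.clm_apply hX).clm_apply hue.self_of_nhds)
  have key := hf.hasDerivAt_boundary hI hτ0 hcX.self_of_nhds hcτ hX hue.self_of_nhds hu'
    hV.hasDerivAt hW
  have hm := hg.hasSmoothCoords hτI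
  have hXX := hm.toCoord_covDerivAlong (huniq τ hτI) hγ.self_of_nhds hp
    (hW.congr_of_eventuallyEq (hcov τ hτI)).hasDerivWithinAt
  have hVX := hm.toCoord_covDerivAlong (huniq τ hτI) hγ.self_of_nhds hp
    hV.hasDerivAt.hasDerivWithinAt
  rw [(hcov τ hτI).self_of_nhds] at hXX
  have hnXτ := hnX.self_of_nhds
  rw [← hXX, ← hVX, ← hnXτ] at key
  rw [hg.index_add_jacobi h12 hτI]
  refine (key.congr_of_eventuallyEq ?_).congr_deriv ?_
  · filter_upwards [hpe, hnX] with t h1 h2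
    rw [boundaryTerm, ← metricCoord_extChartAt (g t) h1, h2]
  · simp only [← metricCoord_extChartAt (g τ) hp, hm.ricci_eq hp, hm.nablaRicci_eq hp]
    rfl

end Derivative

/-! ### Regularity up to τ = 0 in the variable σ = √τ. -/

section SquareRoot

variable {E : Type*} [NormedAddCommGroup E] [NormedSpace ℝ E]
  {M : Type*} [TopologicalSpace M] [ChartedSpace E M] [IsManifold 𝓘(ℝ, E) ∞ M]
  {γ : ℝ → M} {W : ∀ t, TangentSpace 𝓘(ℝ, E) (γ t)} {a b τ : ℝ} {p : M}

/-! ## The variable `σ = √τ` -/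

theorem sq_mem_Icc (ha : 0 ≤ a) (hab : a ≤ b) {σ : ℝ} (hσ : σ ∈ Icc √a √b) :
    σ ^ 2 ∈ Icc a b := by
  have h1 := pow_le_pow_left₀ (Real.sqrt_nonneg a) hσ.1 2
  have h2 := pow_le_pow_left₀ ((Real.sqrt_nonneg a).trans hσ.1) hσ.2 2
  rw [Real.sq_sqrt ha] at h1
  rw [Real.sq_sqrt (ha.trans hab)] at h2
  exact ⟨h1, h2⟩

theorem sqrt_mem_Icc (hτ : τ ∈ Icc a b) : √τ ∈ Icc √a √b :=
  ⟨Real.sqrt_le_sqrt hτ.1, Real.sqrt_le_sqrt hτ.2⟩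

theorem contDiffWithinAt_of_sq {f : ℝ → E} (ha : 0 ≤ a) (h0 : 0 < τ)
    (h : ContDiffWithinAt ℝ ∞ (fun σ => f (σ ^ 2)) (Icc √a √b) √τ) :
    ContDiffWithinAt ℝ ∞ f (Icc a b) τ := by
  have h1 : ContDiffWithinAt ℝ ∞ (fun t => f (√t ^ 2)) (Icc a b) τ :=
    ContDiffWithinAt.comp (g := fun σ => f (σ ^ 2)) (f := fun t => √t) τ h
      (Real.contDiffAt_sqrt h0.ne').contDiffWithinAt fun t ht => sqrt_mem_Icc ht
  exact h1.congr (fun t ht => by rw [Real.sq_sqrt (ha.trans ht.1)])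
    (by rw [Real.sq_sqrt h0.le])

theorem hasDerivWithinAt_of_sq {f : ℝ → E} {f' : E} (ha : 0 ≤ a) (h0 : 0 < τ)
    (h : HasDerivWithinAt (fun σ => f (σ ^ 2)) f' (Icc √a √b) √τ) :
    HasDerivWithinAt f ((1 / (2 * √τ)) • f') (Icc a b) τ := by
  have h1 : HasDerivWithinAt (fun t => f (√t ^ 2)) ((1 / (2 * √τ)) • f') (Icc a b) τ :=
    HasDerivWithinAt.scomp (g₁ := fun σ => f (σ ^ 2)) τ h
      (Real.hasDerivAt_sqrt h0.ne').hasDerivWithinAt fun t ht => sqrt_mem_Icc ht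
  exact h1.congr (fun t ht => by rw [Real.sq_sqrt (ha.trans ht.1)])
    (by rw [Real.sq_sqrt h0.le])

theorem SmoothFieldOn.mono (h : SmoothFieldOn γ W a b) {a' b' : ℝ} (ha : a ≤ a') (hb : b' ≤ b) :
    SmoothFieldOn γ W a' b' :=
  ContMDiffOn.mono h (Icc_subset_Icc (Real.sqrt_le_sqrt ha) (Real.sqrt_le_sqrt hb))

variable (E) in
/-- The coordinates of the curve, as a function of `σ = √τ`. -/
def sqCurve (p : M) (γ : ℝ → M) (σ : ℝ) : E := extChartAt 𝓘(ℝ, E) p (γ (σ ^ 2))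

/-- The coordinates of a vector field along the curve, as a function of `σ = √τ`. -/
def sqField (p : M) (W : ∀ t, TangentSpace 𝓘(ℝ, E) (γ t)) (σ : ℝ) : E :=
  toCoord p (γ (σ ^ 2)) (W (σ ^ 2))

theorem SmoothFieldOn.contDiffWithinAt (h : SmoothFieldOn γ W a b) {σ : ℝ} (hσ : σ ∈ Icc √a √b)
    (hp : γ (σ ^ 2) ∈ (extChartAt 𝓘(ℝ, E) p).source) :
    ContDiffWithinAt ℝ ∞ (sqCurve E p γ) (Icc √a √b) σ ∧
      ContDiffWithinAt ℝ ∞ (sqField p W) (Icc √a √b) σ := by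
  have h1 := (Bundle.Trivialization.contMDiffWithinAt_iff
    (e := trivializationAt E (TangentSpace 𝓘(ℝ, E)) p)
    (by rw [Bundle.Trivialization.mem_source]; exact mem_baseSet hp)).1 (h σ hσ)
  have hp' : γ (σ ^ 2) ∈ (chartAt E p).source := by rwa [← extChartAt_source 𝓘(ℝ, E)]
  have hc : ContMDiffWithinAt 𝓘(ℝ, ℝ) 𝓘(ℝ, E) ∞ (fun σ : ℝ => γ (σ ^ 2)) (Icc √a √b) σ := h1.1
  refine ⟨((contMDiffAt_extChartAt' hp').comp_contMDiffWithinAt σ hc).contDiffWithinAt, ?_⟩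
  refine h1.2.contDiffWithinAt.congr_of_eventuallyEq ?_ ?_
  · filter_upwards [hc.continuousWithinAt.eventually
      ((isOpen_extChartAt_source (I := 𝓘(ℝ, E)) p).mem_nhds hp)] with t ht
    exact Bundle.Trivialization.continuousLinearMapAt_apply_of_mem ℝ _ (mem_baseSet ht) _
  · exact Bundle.Trivialization.continuousLinearMapAt_apply_of_mem ℝ _ (mem_baseSet hp) _

theorem SmoothFieldOn.contDiffWithinAt_time (h : SmoothFieldOn γ W a b) (ha : 0 ≤ a)
    (hτ : τ ∈ Icc a b) (h0 : 0 < τ) (hp : γ τ ∈ (extChartAt 𝓘(ℝ, E) p).source) :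
    ContDiffWithinAt ℝ ∞ (fun t => extChartAt 𝓘(ℝ, E) p (γ t)) (Icc a b) τ ∧
      ContDiffWithinAt ℝ ∞ (fun t => toCoord p (γ t) (W t)) (Icc a b) τ := by
  have hp' : γ (√τ ^ 2) ∈ (extChartAt 𝓘(ℝ, E) p).source := by rwa [Real.sq_sqrt h0.le]
  have h1 := h.contDiffWithinAt (sqrt_mem_Icc hτ) hp'
  exact ⟨contDiffWithinAt_of_sq ha h0 h1.1, contDiffWithinAt_of_sq ha h0 h1.2⟩

/-- `∇_σ W` in coordinates, as a function of `σ = √τ`. -/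
def sqNabla (g : ℝ → Metric E M) (p : M) (W : ∀ t, TangentSpace 𝓘(ℝ, E) (γ t)) (S : Set ℝ)
    (σ : ℝ) : E :=
  derivWithin (sqField p W) S σ
    + christoffelL (metricCoord (g (σ ^ 2)) p) (sqCurve E p γ σ) (derivWithin (sqCurve E p γ) S σ)
      (sqField p W σ)

variable [FiniteDimensional ℝ E] {g : ℝ → Metric E M} {τ₁ τ₂ : ℝ}
  {U V : ∀ t, TangentSpace 𝓘(ℝ, E) (γ t)}

/-- The possible blow-up of X at τ = 0 is isolated in the scalar (2σ)⁻¹; the other factor is smooth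
up to σ = 0. -/
theorem toCoord_velocity_sq (h : SmoothFieldOn γ W a b) (ha : 0 ≤ a) (hab : a < b)
    (hs : Icc a b ⊆ Icc τ₁ τ₂) (hτ : τ ∈ Icc a b) (h0 : 0 < τ)
    (hγ : MDifferentiableWithinAt 𝓘(ℝ, ℝ) 𝓘(ℝ, E) γ (Icc τ₁ τ₂) τ)
    (hp : γ τ ∈ (extChartAt 𝓘(ℝ, E) p).source) :
    toCoord p (γ τ) (velocity γ (Icc τ₁ τ₂) τ)
      = (1 / (2 * √τ)) • derivWithin (sqCurve E p γ) (Icc √a √b) √τ := by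
  have hp' : γ (√τ ^ 2) ∈ (extChartAt 𝓘(ℝ, E) p).source := by rwa [Real.sq_sqrt h0.le]
  have h1 := ((h.contDiffWithinAt (sqrt_mem_Icc hτ) hp').1.differentiableWithinAt
    (by simp)).hasDerivWithinAt
  exact (uniqueDiffOn_Icc hab τ hτ).eq_deriv _ ((hasDerivWithinAt_extChartAt hγ hp).mono hs)
    (hasDerivWithinAt_of_sq (f := fun t => extChartAt 𝓘(ℝ, E) p (γ t)) ha h0 h1)

theorem toCoord_nablaX_sq (hg : IsBackwardsRicciFlow g τ₁ τ₂) (h : SmoothFieldOn γ W a b)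
    (ha : 0 ≤ a) (hab : a < b)
    (hs : Icc a b ⊆ Icc τ₁ τ₂) (hτ : τ ∈ Icc a b) (h0 : 0 < τ)
    (hγ : MDifferentiableWithinAt 𝓘(ℝ, ℝ) 𝓘(ℝ, E) γ (Icc τ₁ τ₂) τ)
    (hp : γ τ ∈ (extChartAt 𝓘(ℝ, E) p).source)
    (hW : DifferentiableWithinAt ℝ (fun t => toCoord p (γ t) (W t)) (Icc τ₁ τ₂) τ) :
    toCoord p (γ τ) (nablaX g γ (Icc τ₁ τ₂) W τ)
      = (1 / (2 * √τ)) • sqNabla g p W (Icc √a √b) √τ := by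
  have hp' : γ (√τ ^ 2) ∈ (extChartAt 𝓘(ℝ, E) p).source := by rwa [Real.sq_sqrt h0.le]
  have h12 : τ₁ < τ₂ := (hs ⟨le_rfl, hab.le⟩).1.trans_lt (hab.trans_le (hs ⟨hab.le, le_rfl⟩).2)
  have h1 := ((h.contDiffWithinAt (sqrt_mem_Icc hτ) hp').2.differentiableWithinAt
    (by simp)).hasDerivWithinAt
  have h2 := (uniqueDiffOn_Icc hab τ hτ).eq_deriv _ (hW.hasDerivWithinAt.mono hs)
    (hasDerivWithinAt_of_sq (f := fun t => toCoord p (γ t) (W t)) ha h0 h1)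
  have h3 := (hg.hasSmoothCoords (hs hτ)).toCoord_covDerivAlong
    (uniqueDiffOn_Icc h12 τ (hs hτ)) hγ hp hW.hasDerivWithinAt
  rw [nablaX, h3, h2, toCoord_velocity_sq h ha hab hs hτ h0 hγ hp, sqNabla, sqField, sqCurve,
    Real.sq_sqrt h0.le, smul_add, map_smul, smul_apply]

theorem SmoothFamily.contDiffOn_sq {G : Type*} [NormedAddCommGroup G] [NormedSpace ℝ G]
    {F : ℝ → E → G} {I : Set ℝ} {O : Set E} (hF : SmoothFamily F I O) {S : Set ℝ} {c : ℝ → E}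
    (hc : ContDiffOn ℝ ∞ c S) (hI : ∀ σ ∈ S, σ ^ 2 ∈ I) (hO : ∀ σ ∈ S, c σ ∈ O) :
    ContDiffOn ℝ ∞ (fun σ => F (σ ^ 2) (c σ)) S :=
  ContDiffOn.comp (g := fun z : ℝ × E => F z.1 z.2) (f := fun σ => (σ ^ 2, c σ)) hF
    (by fun_prop) fun σ hσ => ⟨hI σ hσ, hO σ hσ⟩

/-- The integrand of the index form, multiplied by `σ`, as a function of `σ = √τ`. -/
def sqIndex (g : ℝ → Metric E M) (p : M) (U V : ∀ t, TangentSpace 𝓘(ℝ, E) (γ t)) (S : Set ℝ)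
    (σ : ℝ) : ℝ :=
  let B := metricCoord (g (σ ^ 2)) p
  let c := sqCurve E p γ σ
  let X := derivWithin (sqCurve E p γ) S σ
  let u := sqField p U σ
  let v := sqField p V σ
  σ ^ 2 * B c (covDerivCoord B (gradCoord B (scalarCoord B)) c u) v
    + 1 / 2 * B c (sqNabla g p U S σ) (sqNabla g p V S σ)
    + 1 / 2 * B c (riemannF B c u X v) X
    - σ * nablaRicciCoord B c u v X - σ * nablaRicciCoord B c v u X
    + σ * nablaRicciCoord B c X u v

/-- The boundary term, as a function of `σ = √τ`. -/
def sqBoundary (g : ℝ → Metric E M) (p : M) (U V : ∀ t, TangentSpace 𝓘(ℝ, E) (γ t)) (S : Set ℝ)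
    (σ : ℝ) : ℝ :=
  metricCoord (g (σ ^ 2)) p (sqCurve E p γ σ) (sqNabla g p U S σ) (sqField p V σ)

/-- Count powers of σ: each X or ∇_X costs (2σ)⁻¹. Terms with two of them become σ·2/(4σ²) = σ⁻¹/2,
terms with one become 1, and the Hessian term keeps σ. The open interval is needed since V may have
corners at a and b. -/
theorem indexIntegrand_sq (hg : IsBackwardsRicciFlow g τ₁ τ₂) (hU : SmoothFieldOn γ U a b)
    (hV : SmoothFieldOn γ V a b) (ha : 0 ≤ a) (hab : a < b)
    (hs : Icc a b ⊆ Icc τ₁ τ₂) (hτ : τ ∈ Ioo a b)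
    (hγ : MDifferentiableWithinAt 𝓘(ℝ, ℝ) 𝓘(ℝ, E) γ (Icc τ₁ τ₂) τ)
    (hp : γ τ ∈ (extChartAt 𝓘(ℝ, E) p).source) :
    indexIntegrand g γ (Icc τ₁ τ₂) U V τ = (√τ)⁻¹ * sqIndex g p U V (Icc √a √b) √τ := by
  have hτI := Ioo_subset_Icc_self hτ
  have h0 : 0 < τ := ha.trans_lt hτ.1
  have hd : ∀ W : (∀ t, TangentSpace 𝓘(ℝ, E) (γ t)), SmoothFieldOn γ W a b →
      DifferentiableWithinAt ℝ (fun t => toCoord p (γ t) (W t)) (Icc τ₁ τ₂) τ := fun W hW =>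
    ((((hW.contDiffWithinAt_time ha hτI h0 hp).2).differentiableWithinAt
      (by simp)).differentiableAt (Icc_mem_nhds hτ.1 hτ.2)).differentiableWithinAt
  have hm := hg.hasSmoothCoords (hs hτI)
  have hcτ : extChartAt 𝓘(ℝ, E) p (γ τ) ∈ (extChartAt 𝓘(ℝ, E) p).target :=
    (extChartAt 𝓘(ℝ, E) p).map_source hp
  have hσ : 0 < √τ := Real.sqrt_pos.2 h0
  rw [indexIntegrand, hm.hessScalar_eq]
  simp only [← metricCoord_extChartAt (g τ) hp, hm.nablaRicci_eq hp, hm.toCoord_riemann hp,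
    hm.toCoord_covDerivGradScalar hp, toCoord_velocity_sq hU ha hab hs hτI h0 hγ hp,
    toCoord_nablaX_sq hg hU ha hab hs hτI h0 hγ hp (hd U hU),
    toCoord_nablaX_sq hg hV ha hab hs hτI h0 hγ hp (hd V hV)]
  simp only [sqIndex, sqCurve, sqField, (hm p).nablaRicciCoord hcτ, riemannF, Real.sq_sqrt h0.le,
    map_smul, smul_apply, smul_eq_mul, map_add, map_sub, add_apply, sub_apply]
  field_simp
  rw [Real.sq_sqrt h0.le]
  ring

/-- The factor 2σ cancels (2σ)⁻¹. Only U is differentiated, so positive end points of the piece are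
allowed. -/
theorem boundaryTerm_sq (hg : IsBackwardsRicciFlow g τ₁ τ₂) (hU : SmoothFieldOn γ U a b)
    (ha : 0 ≤ a) (hab : a < b)
    (hs : Icc a b ⊆ Icc τ₁ τ₂) (hτ : τ ∈ Icc a b) (h0 : 0 < τ)
    (hγ : MDifferentiableWithinAt 𝓘(ℝ, ℝ) 𝓘(ℝ, E) γ (Icc τ₁ τ₂) τ)
    (hp : γ τ ∈ (extChartAt 𝓘(ℝ, E) p).source)
    (hUd : DifferentiableWithinAt ℝ (fun t => toCoord p (γ t) (U t)) (Icc τ₁ τ₂) τ) :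
    boundaryTerm g γ (Icc τ₁ τ₂) U V τ = sqBoundary g p U V (Icc √a √b) √τ := by
  have hσ : 0 < √τ := Real.sqrt_pos.2 h0
  rw [boundaryTerm, sqBoundary, ← metricCoord_extChartAt (g τ) hp,
    toCoord_nablaX_sq hg hU ha hab hs hτ h0 hγ hp hUd, sqCurve, sqField, Real.sq_sqrt h0.le,
    map_smul, smul_apply, smul_eq_mul]
  field_simp

section Regularity

theorem contDiffOn_sqCurve (hU : SmoothFieldOn γ U a b) (ha : 0 ≤ a) (hab : a ≤ b)
    (hp : ∀ t ∈ Icc a b, γ t ∈ (extChartAt 𝓘(ℝ, E) p).source) :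
    ContDiffOn ℝ ∞ (sqCurve E p γ) (Icc √a √b) :=
  fun _ hσ => (hU.contDiffWithinAt hσ (hp _ (sq_mem_Icc ha hab hσ))).1

theorem contDiffOn_sqField (hU : SmoothFieldOn γ U a b) (ha : 0 ≤ a) (hab : a ≤ b)
    (hp : ∀ t ∈ Icc a b, γ t ∈ (extChartAt 𝓘(ℝ, E) p).source) :
    ContDiffOn ℝ ∞ (sqField p U) (Icc √a √b) :=
  fun _ hσ => (hU.contDiffWithinAt hσ (hp _ (sq_mem_Icc ha hab hσ))).2

theorem SmoothFamily.contDiffOn_comp_sqCurve {F : Type*} [NormedAddCommGroup F] [NormedSpace ℝ F]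
    {K : ℝ → E → F} (hK : SmoothFamily K (Icc τ₁ τ₂) (extChartAt 𝓘(ℝ, E) p).target)
    (hU : SmoothFieldOn γ U a b) (ha : 0 ≤ a) (hab : a ≤ b) (hs : Icc a b ⊆ Icc τ₁ τ₂)
    (hp : ∀ t ∈ Icc a b, γ t ∈ (extChartAt 𝓘(ℝ, E) p).source) :
    ContDiffOn ℝ ∞ (fun σ => K (σ ^ 2) (sqCurve E p γ σ)) (Icc √a √b) :=
  hK.contDiffOn_sq (contDiffOn_sqCurve hU ha hab hp) (fun _ hσ => hs (sq_mem_Icc ha hab hσ))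
    fun _ hσ => (extChartAt 𝓘(ℝ, E) p).map_source (hp _ (sq_mem_Icc ha hab hσ))

theorem contDiffOn_sqNabla (hg : IsBackwardsRicciFlow g τ₁ τ₂) (hU : SmoothFieldOn γ U a b)
    (ha : 0 ≤ a) (hab : a < b) (hs : Icc a b ⊆ Icc τ₁ τ₂)
    (hp : ∀ t ∈ Icc a b, γ t ∈ (extChartAt 𝓘(ℝ, E) p).source) :
    ContDiffOn ℝ ∞ (sqNabla g p U (Icc √a √b)) (Icc √a √b) := by
  have hS := uniqueDiffOn_Icc (Real.sqrt_lt_sqrt ha hab)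
  have h1 := contDiffOn_sqField hU ha hab.le hp
  have h2 := (contDiffOn_sqCurve hU ha hab.le hp).derivWithin (m := ∞) hS (by simp)
  have h3 := h1.derivWithin (m := ∞) hS (by simp)
  have h4 := SmoothFamily.contDiffOn_comp_sqCurve (hg.isMetricFamily p).smooth_christoffelL hU ha hab.le hs hp
  unfold sqNabla
  fun_prop

theorem contDiffOn_sqBoundary (hg : IsBackwardsRicciFlow g τ₁ τ₂) (hU : SmoothFieldOn γ U a b)
    (hV : SmoothFieldOn γ V a b) (ha : 0 ≤ a) (hab : a < b) (hs : Icc a b ⊆ Icc τ₁ τ₂)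
    (hp : ∀ t ∈ Icc a b, γ t ∈ (extChartAt 𝓘(ℝ, E) p).source) :
    ContDiffOn ℝ ∞ (sqBoundary g p U V (Icc √a √b)) (Icc √a √b) := by
  have h1 := contDiffOn_sqField hV ha hab.le hp
  have h2 := contDiffOn_sqNabla hg hU ha hab hs hp
  have h3 := SmoothFamily.contDiffOn_comp_sqCurve (hg.isMetricFamily p).smooth hU ha hab.le hs hp
  unfold sqBoundary
  fun_prop

theorem contDiffOn_covDerivGrad_sq (hg : IsBackwardsRicciFlow g τ₁ τ₂)
    (hU : SmoothFieldOn γ U a b) (ha : 0 ≤ a) (hab : a ≤ b) (hs : Icc a b ⊆ Icc τ₁ τ₂)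
    (hp : ∀ t ∈ Icc a b, γ t ∈ (extChartAt 𝓘(ℝ, E) p).source) :
    ContDiffOn ℝ ∞ (fun σ => covDerivCoord (metricCoord (g (σ ^ 2)) p)
      (gradCoord (metricCoord (g (σ ^ 2)) p) (scalarCoord (metricCoord (g (σ ^ 2)) p)))
      (sqCurve E p γ σ) (sqField p U σ)) (Icc √a √b) := by
  have hm := hg.isMetricFamily p
  have hu := contDiffOn_sqField hU ha hab hp
  have hΓ := SmoothFamily.contDiffOn_comp_sqCurve hm.smooth_christoffelL hU ha hab hs hp
  have hG := SmoothFamily.contDiffOn_comp_sqCurve hm.smooth_gradCoord hU ha hab hs hp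
  have hDG := SmoothFamily.contDiffOn_comp_sqCurve (hm.smooth_gradCoord.smooth_fderiv hm.isOpen)
    hU ha hab hs hp
  refine ContDiffOn.congr ((hDG.clm_apply hu).add ((hΓ.clm_apply hu).clm_apply hG)) fun σ hσ => ?_
  exact (hm.slice (hs (sq_mem_Icc ha hab hσ))).covDerivCoord
    ((extChartAt 𝓘(ℝ, E) p).map_source (hp _ (sq_mem_Icc ha hab hσ))) _ _

theorem contDiffOn_riemannF_sq (hg : IsBackwardsRicciFlow g τ₁ τ₂)
    (hU : SmoothFieldOn γ U a b) (ha : 0 ≤ a) (hab : a ≤ b) (hs : Icc a b ⊆ Icc τ₁ τ₂)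
    (hp : ∀ t ∈ Icc a b, γ t ∈ (extChartAt 𝓘(ℝ, E) p).source) {x y z : ℝ → E}
    (hx : ContDiffOn ℝ ∞ x (Icc √a √b)) (hy : ContDiffOn ℝ ∞ y (Icc √a √b))
    (hz : ContDiffOn ℝ ∞ z (Icc √a √b)) :
    ContDiffOn ℝ ∞ (fun σ => riemannF (metricCoord (g (σ ^ 2)) p)
      (sqCurve E p γ σ) (x σ) (y σ) (z σ)) (Icc √a √b) := by
  have hm := hg.isMetricFamily p
  have hΓ := SmoothFamily.contDiffOn_comp_sqCurve hm.smooth_christoffelL hU ha hab hs hp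
  have hDΓ := SmoothFamily.contDiffOn_comp_sqCurve (hm.smooth_christoffelL.smooth_fderiv hm.isOpen)
    hU ha hab hs hp
  exact ((((hDΓ.clm_apply hx).clm_apply hy).clm_apply hz).add
      ((hΓ.clm_apply hx).clm_apply ((hΓ.clm_apply hy).clm_apply hz))).sub
    ((((hDΓ.clm_apply hy).clm_apply hx).clm_apply hz).add
      ((hΓ.clm_apply hy).clm_apply ((hΓ.clm_apply hx).clm_apply hz)))

theorem contDiffOn_nablaRicci_sq (hg : IsBackwardsRicciFlow g τ₁ τ₂)
    (hU : SmoothFieldOn γ U a b) (ha : 0 ≤ a) (hab : a ≤ b) (hs : Icc a b ⊆ Icc τ₁ τ₂)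
    (hp : ∀ t ∈ Icc a b, γ t ∈ (extChartAt 𝓘(ℝ, E) p).source) {x y z : ℝ → E}
    (hx : ContDiffOn ℝ ∞ x (Icc √a √b)) (hy : ContDiffOn ℝ ∞ y (Icc √a √b))
    (hz : ContDiffOn ℝ ∞ z (Icc √a √b)) :
    ContDiffOn ℝ ∞ (fun σ => nablaRicciCoord (metricCoord (g (σ ^ 2)) p)
      (sqCurve E p γ σ) (x σ) (y σ) (z σ)) (Icc √a √b) := by
  have hm := hg.isMetricFamily p
  have hΓ := SmoothFamily.contDiffOn_comp_sqCurve hm.smooth_christoffelL hU ha hab hs hp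
  have hR := SmoothFamily.contDiffOn_comp_sqCurve hm.smooth_ricciL hU ha hab hs hp
  have hDR := SmoothFamily.contDiffOn_comp_sqCurve (hm.smooth_ricciL.smooth_fderiv hm.isOpen)
    hU ha hab hs hp
  refine ContDiffOn.congr (((((hDR.clm_apply hx).clm_apply hy).clm_apply hz).sub
    ((hR.clm_apply ((hΓ.clm_apply hx).clm_apply hy)).clm_apply hz)).sub
    ((hR.clm_apply hy).clm_apply ((hΓ.clm_apply hx).clm_apply hz))) fun σ hσ => ?_
  exact (hm.slice (hs (sq_mem_Icc ha hab hσ))).nablaRicciCoord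
    ((extChartAt 𝓘(ℝ, E) p).map_source (hp _ (sq_mem_Icc ha hab hσ))) _ _ _

theorem contDiffOn_sqIndex (hg : IsBackwardsRicciFlow g τ₁ τ₂) (hU : SmoothFieldOn γ U a b)
    (hV : SmoothFieldOn γ V a b) (ha : 0 ≤ a) (hab : a < b) (hs : Icc a b ⊆ Icc τ₁ τ₂)
    (hp : ∀ t ∈ Icc a b, γ t ∈ (extChartAt 𝓘(ℝ, E) p).source) :
    ContDiffOn ℝ ∞ (sqIndex g p U V (Icc √a √b)) (Icc √a √b) := by
  have hS := uniqueDiffOn_Icc (Real.sqrt_lt_sqrt ha hab)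
  have hu := contDiffOn_sqField hU ha hab.le hp
  have hv := contDiffOn_sqField hV ha hab.le hp
  have hX := (contDiffOn_sqCurve hU ha hab.le hp).derivWithin (m := ∞) hS (by simp)
  have hB := SmoothFamily.contDiffOn_comp_sqCurve (hg.isMetricFamily p).smooth hU ha hab.le hs hp
  have h1 := (hB.clm_apply (contDiffOn_covDerivGrad_sq hg hU ha hab.le hs hp)).clm_apply hv
  have h2 := (hB.clm_apply (contDiffOn_sqNabla hg hU ha hab hs hp)).clm_apply
    (contDiffOn_sqNabla hg hV ha hab hs hp)
  have h3 := (hB.clm_apply (contDiffOn_riemannF_sq hg hU ha hab.le hs hp hu hX hv)).clm_apply hX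
  have h4 := contDiffOn_nablaRicci_sq hg hU ha hab.le hs hp hu hv hX
  have h5 := contDiffOn_nablaRicci_sq hg hU ha hab.le hs hp hv hu hX
  have h6 := contDiffOn_nablaRicci_sq hg hU ha hab.le hs hp hX hu hv
  have hσ : ContDiffOn ℝ ∞ (fun σ : ℝ => σ) (Icc √a √b) := contDiffOn_id
  exact ((((((hσ.pow 2).mul h1).add (contDiffOn_const.mul h2)).add (contDiffOn_const.mul h3)).sub
    (hσ.mul h4)).sub (hσ.mul h5)).add (hσ.mul h6)

end Regularity

end SquareRoot

/-! ### The fundamental theorem of calculus on each piece, and gluing. -/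

section ByParts

variable {E : Type*} [NormedAddCommGroup E] [NormedSpace ℝ E] [FiniteDimensional ℝ E]
  {M : Type*} [TopologicalSpace M] [ChartedSpace E M] [IsManifold 𝓘(ℝ, E) ∞ M]
  {γ : ℝ → M} {g : ℝ → Metric E M} {τ₁ τ₂ a b c τ : ℝ}
  {U V : ∀ t, TangentSpace 𝓘(ℝ, E) (γ t)} {p : M}

/-! ## Integration by parts -/

/-- The power τ^(-1/2) is integrable up to 0, and the other factor is continuous. -/
theorem intervalIntegrable_inv_sqrt_mul {K : ℝ → ℝ} (ha : 0 ≤ a) (hab : a ≤ b)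
    (hK : ContinuousOn K (Icc √a √b)) :
    IntervalIntegrable (fun t => (√t)⁻¹ * K √t) volume a b := by
  have h1 : IntervalIntegrable (fun t : ℝ => t ^ (-(1 / 2) : ℝ)) volume a b :=
    intervalIntegral.intervalIntegrable_rpow' (by norm_num)
  have h2 : ContinuousOn (fun t => K √t) (uIcc a b) := by
    rw [uIcc_of_le hab]
    exact hK.comp Real.continuous_sqrt.continuousOn fun t ht => sqrt_mem_Icc ht
  refine (h1.mul_continuousOn h2).congr_uIoo fun t ht => ?_
  rw [uIoo_of_le hab] at ht
  beta_reduce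
  rw [Real.rpow_neg (ha.trans ht.1.le), ← Real.sqrt_eq_rpow]

/-- The formula of integration by parts on `[a, b]`, `0 ≤ a`. -/
def HasByParts (g : ℝ → Metric E M) (γ : ℝ → M) (s : Set ℝ)
    (U V : ∀ t, TangentSpace 𝓘(ℝ, E) (γ t)) (a b : ℝ) : Prop :=
  IntervalIntegrable (indexIntegrand g γ s U V) volume a b ∧
    IntervalIntegrable (jacobiIntegrand g γ s U V) volume a b ∧
    ∃ β : ℝ, (0 < a → β = boundaryTerm g γ s U V a) ∧
      (a = 0 → Tendsto (boundaryTerm g γ s U V) (𝓝[>] 0) (𝓝 β)) ∧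
      ∫ τ in a..b, indexIntegrand g γ s U V τ
        = boundaryTerm g γ s U V b - β - 2 * ∫ τ in a..b, jacobiIntegrand g γ s U V τ

/-- At b > 0 the lower boundary value of the second piece is the value of the boundary term itself,
so the two contributions cancel. No jump occurs at a corner of V, whose derivative does not enter
there. -/
theorem HasByParts.trans {s : Set ℝ} (h : HasByParts g γ s U V a b) (hb : 0 < b)
    (h' : HasByParts g γ s U V b c) : HasByParts g γ s U V a c := by
  obtain ⟨hi, hj, β, hβ, hβ0, h1⟩ := h
  obtain ⟨hi', hj', β', hβ', -, h2⟩ := h'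
  refine ⟨hi.trans hi', hj.trans hj', β, hβ, hβ0, ?_⟩
  rw [← intervalIntegral.integral_add_adjacent_intervals hi hi',
    ← intervalIntegral.integral_add_adjacent_intervals hj hj', h1, h2, hβ' hb]
  ring

theorem IsLGeodesic.mdifferentiableWithinAt (hγ : IsLGeodesic g γ τ₁ τ₂)
    (hτ : τ ∈ Icc τ₁ τ₂) (h0 : 0 < τ) :
    MDifferentiableWithinAt 𝓘(ℝ, ℝ) 𝓘(ℝ, E) γ (Icc τ₁ τ₂) τ :=
  ((hγ.smooth τ ⟨hτ, h0⟩).mdifferentiableWithinAt (by simp)).mono_of_mem_nhdsWithin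
    (inter_mem self_mem_nhdsWithin (mem_nhdsWithin_of_mem_nhds (Ioi_mem_nhds h0)))

/-- Integration by parts on an interval on which the curve stays in one chart. -/
theorem hasByParts_of_chart (hτ₁ : 0 ≤ τ₁) (hg : IsBackwardsRicciFlow g τ₁ τ₂)
    (hγ : IsLGeodesic g γ τ₁ τ₂) (hU : SmoothFieldOn γ U τ₁ τ₂) (h₁ : τ₁ ≤ a) (hab : a < b)
    (h₂ : b ≤ τ₂) (hV : SmoothFieldOn γ V a b)
    (hp : ∀ t ∈ Icc a b, γ t ∈ (extChartAt 𝓘(ℝ, E) p).source) :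
    HasByParts g γ (Icc τ₁ τ₂) U V a b := by
  have ha : 0 ≤ a := hτ₁.trans h₁
  have hs : Icc a b ⊆ Icc τ₁ τ₂ := Icc_subset_Icc h₁ h₂
  have hU' := hU.mono h₁ h₂
  have hS : √a < √b := Real.sqrt_lt_sqrt ha hab
  set H := sqBoundary g p U V (Icc √a √b)
  set K := sqIndex g p U V (Icc √a √b)
  have hH : ContDiffOn ℝ ∞ H (Icc √a √b) := contDiffOn_sqBoundary hg hU' hV ha hab hs hp
  have hK : ContDiffOn ℝ ∞ K (Icc √a √b) := contDiffOn_sqIndex hg hU' hV ha hab hs hp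
  have hbd : ∀ t ∈ Icc a b, 0 < t → boundaryTerm g γ (Icc τ₁ τ₂) U V t = H √t :=
    fun t ht h0 => boundaryTerm_sq hg hU' ha hab hs ht h0
      (hγ.mdifferentiableWithinAt (hs ht) h0) (hp t ht)
      ((hU.contDiffWithinAt_time hτ₁ (hs ht) h0 (hp t ht)).2.differentiableWithinAt (by simp))
  have hidx : ∀ t ∈ Ioo a b, (√t)⁻¹ * K √t = indexIntegrand g γ (Icc τ₁ τ₂) U V t :=
    fun t ht => (indexIntegrand_sq hg hU' hV ha hab hs ht (hγ.mdifferentiableWithinAt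
      (hs (Ioo_subset_Icc_self ht)) (ha.trans_lt ht.1)) (hp t (Ioo_subset_Icc_self ht))).symm
  have hder : ∀ t ∈ Ioo a b, HasDerivAt (boundaryTerm g γ (Icc τ₁ τ₂) U V)
      (indexIntegrand g γ (Icc τ₁ τ₂) U V t + 2 * jacobiIntegrand g γ (Icc τ₁ τ₂) U V t) t := by
    intro t ht
    have h0 := ha.trans_lt ht.1
    have htI := Ioo_subset_Icc_self ht
    have hn := Icc_mem_nhds ht.1 ht.2
    have h1 := hU'.contDiffWithinAt_time ha htI h0 (hp t htI)
    have h2 := hV.contDiffWithinAt_time ha htI h0 (hp t htI)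
    refine hg.hasDerivAt_boundaryTerm ⟨h₁.trans_lt ht.1, ht.2.trans_le h₂⟩ h0 ?_ (hp t htI)
      (h1.1.contDiffAt hn) (h1.2.contDiffAt hn) ((h2.2.contDiffAt hn).differentiableAt (by simp))
    filter_upwards [Ioo_mem_nhds ht.1 ht.2] with r hr
    exact hγ.mdifferentiableWithinAt (hs (Ioo_subset_Icc_self hr)) (ha.trans_lt hr.1)
  -- Two computations of one derivative: the geometric identity, and the chain rule for H(√t). The
  -- second shows that the sum of the integrands is integrable.
  have hsum : ∀ t ∈ Ioo a b, (√t)⁻¹ * (1 / 2 * derivWithin H (Icc √a √b) √t)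
      = indexIntegrand g γ (Icc τ₁ τ₂) U V t + 2 * jacobiIntegrand g γ (Icc τ₁ τ₂) U V t := by
    intro t ht
    have h0 := ha.trans_lt ht.1
    have hn : Icc √a √b ∈ 𝓝 √t :=
      Icc_mem_nhds (Real.sqrt_lt_sqrt ha ht.1) (Real.sqrt_lt_sqrt h0.le ht.2)
    have h1 : HasDerivAt H (derivWithin H (Icc √a √b) √t) √t :=
      ((hH.differentiableOn (by simp)) √t
        (sqrt_mem_Icc (Ioo_subset_Icc_self ht))).hasDerivWithinAt.hasDerivAt hn
    have h2 : HasDerivAt (fun t => H √t) _ t := h1.comp t (Real.hasDerivAt_sqrt h0.ne')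
    have h3 := h2.congr_of_eventuallyEq (f₁ := boundaryTerm g γ (Icc τ₁ τ₂) U V) (by
      filter_upwards [Ioo_mem_nhds ht.1 ht.2] with r hr
      exact hbd r (Ioo_subset_Icc_self hr) (ha.trans_lt hr.1))
    rw [(hder t ht).unique h3]
    field_simp
  have hint : IntervalIntegrable (indexIntegrand g γ (Icc τ₁ τ₂) U V) volume a b :=
    (intervalIntegrable_inv_sqrt_mul ha hab.le hK.continuousOn).congr_uIoo fun t ht =>
      hidx t (by rwa [uIoo_of_le hab.le] at ht)
  have hint2 : IntervalIntegrable (fun t => indexIntegrand g γ (Icc τ₁ τ₂) U V t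
      + 2 * jacobiIntegrand g γ (Icc τ₁ τ₂) U V t) volume a b :=
    (intervalIntegrable_inv_sqrt_mul (K := fun σ => 1 / 2 * derivWithin H (Icc √a √b) σ) ha hab.le
      (continuousOn_const.mul (hH.continuousOn_derivWithin (uniqueDiffOn_Icc hS)
        (by simp)))).congr_uIoo fun t ht => hsum t (by rwa [uIoo_of_le hab.le] at ht)
  -- Subtraction avoids expanding ∇_X∇_X U near τ = 0.
  have hjac : IntervalIntegrable (jacobiIntegrand g γ (Icc τ₁ τ₂) U V) volume a b := by
    have := (hint2.sub hint).const_mul (1 / 2)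
    refine this.congr_uIoo fun t _ => ?_
    beta_reduce
    ring
  have hlim : ∀ t ∈ Icc a b, Tendsto (fun r => H √r) (𝓝[Icc a b] t) (𝓝 (H √t)) := fun t ht =>
    (hH.continuousOn.comp Real.continuous_sqrt.continuousOn fun r hr => sqrt_mem_Icc hr) t ht
  -- A limit is required: at a = 0 the literal value of `boundaryTerm` is 0 because of its factor
  -- √0, whereas the correct boundary value is H(0).
  have hla : Tendsto (boundaryTerm g γ (Icc τ₁ τ₂) U V) (𝓝[>] a) (𝓝 (H √a)) := by
    refine Tendsto.congr' ?_ ((hlim a ⟨le_rfl, hab.le⟩).mono_left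
      (nhdsWithin_le_of_mem (mem_of_superset (Ioo_mem_nhdsGT hab) Ioo_subset_Icc_self)))
    filter_upwards [Ioo_mem_nhdsGT hab] with r hr
    exact (hbd r (Ioo_subset_Icc_self hr) (ha.trans_lt hr.1)).symm
  have hlb : Tendsto (boundaryTerm g γ (Icc τ₁ τ₂) U V) (𝓝[<] b) (𝓝 (H √b)) := by
    refine Tendsto.congr' ?_ ((hlim b ⟨hab.le, le_rfl⟩).mono_left
      (nhdsWithin_le_of_mem (mem_of_superset (Ioo_mem_nhdsLT hab) Ioo_subset_Icc_self)))
    filter_upwards [Ioo_mem_nhdsLT hab] with r hr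
    exact (hbd r (Ioo_subset_Icc_self hr) (ha.trans_lt hr.1)).symm
  have key := intervalIntegral.integral_eq_sub_of_hasDerivAt_of_tendsto hab hder hint2 hla hlb
  rw [intervalIntegral.integral_add hint (hjac.const_mul 2),
    intervalIntegral.integral_const_mul] at key
  refine ⟨hint, hjac, H √a, fun h0 => (hbd a ⟨le_rfl, hab.le⟩ h0).symm, ?_, ?_⟩
  · rintro rfl
    exact hla
  · rw [hbd b ⟨hab.le, le_rfl⟩ (ha.trans_lt hab)]
    linarith

/-- A transitive property of intervals holds on `[t 0, t n]` if it holds on the non-degenerate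
intervals `[t i, t (i + 1)]`. -/
theorem chain_of_le {P : ℝ → ℝ → Prop} {t : ℕ → ℝ} {n : ℕ} (h0 : 0 ≤ t 0)
    (ht : ∀ i < n, t i ≤ t (i + 1))
    (hP : ∀ i < n, t i < t (i + 1) → P (t i) (t (i + 1)))
    (htrans : ∀ a b c, 0 < b → P a b → P b c → P a c) :
    t 0 ≤ t n ∧ (t 0 < t n → P (t 0) (t n)) := by
  induction n with
  | zero => exact ⟨le_rfl, fun h => absurd h (lt_irrefl _)⟩
  | succ n ih =>
    obtain ⟨h1, h2⟩ := ih (fun i hi => ht i (by omega)) fun i hi => hP i (by omega)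
    have h3 := ht n (by omega)
    have h4 := hP n (by omega)
    refine ⟨h1.trans h3, fun h => ?_⟩
    -- A degenerate piece contributes nothing. If both are non-degenerate, the middle point exceeds
    -- `t 0 ≥ 0`, hence is positive as `htrans` demands.
    rcases h1.eq_or_lt with h5 | h5
    · rw [h5] at h ⊢
      exact h4 h
    · rcases h3.eq_or_lt with h6 | h6
      · rw [← h6]
        exact h2 h5
      · exact htrans _ _ _ (h0.trans_lt h5) (h2 h5) (h4 h6)

/-- Preimages of chart domains cover the compact interval, so a finite subdivision puts each piece
in one chart. `HasByParts` mentions no chart, so pieces computed in different charts can be glued.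
-/
theorem hasByParts_of_smooth (hτ₁ : 0 ≤ τ₁) (hg : IsBackwardsRicciFlow g τ₁ τ₂)
    (hγ : IsLGeodesic g γ τ₁ τ₂) (hU : SmoothFieldOn γ U τ₁ τ₂) (h₁ : τ₁ ≤ a) (hab : a < b)
    (h₂ : b ≤ τ₂) (hV : SmoothFieldOn γ V a b) : HasByParts g γ (Icc τ₁ τ₂) U V a b := by
  have hc : Continuous fun t : Icc a b => γ t :=
    continuousOn_iff_continuous_domRestrict.1 (hγ.continuousOn.mono (Icc_subset_Icc h₁ h₂))
  obtain ⟨t, ht0, hmono, ⟨m, hm⟩, hcov⟩ := exists_monotone_Icc_subset_open_cover_Icc hab.le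
    (c := fun p : M => (fun t : Icc a b => γ t) ⁻¹' (extChartAt 𝓘(ℝ, E) p).source)
    (fun p => (isOpen_extChartAt_source (I := 𝓘(ℝ, E)) p).preimage hc)
    fun t _ => mem_iUnion.2 ⟨γ t, mem_extChartAt_source (I := 𝓘(ℝ, E)) (γ t)⟩
  have key := chain_of_le (P := HasByParts g γ (Icc τ₁ τ₂) U V) (t := fun n => (t n : ℝ)) (n := m)
    (by rw [ht0]; exact hτ₁.trans h₁) (fun i _ => hmono (Nat.le_succ i))
    (fun i _ hi => by
      obtain ⟨p, hp⟩ := hcov i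
      exact hasByParts_of_chart (p := p) hτ₁ hg hγ hU (h₁.trans (t i).2.1) hi
        ((t (i + 1)).2.2.trans h₂) (hV.mono (t i).2.1 (t (i + 1)).2.2) fun r hr =>
          hp (show (⟨r, (t i).2.1.trans hr.1, hr.2.trans (t (i + 1)).2.2⟩ : Icc a b) ∈ _ from
            ⟨hr.1, hr.2⟩))
    fun _ _ _ hb h h' => h.trans hb h'
  simp only [ht0, hm m le_rfl] at key
  exact key.2 hab

theorem hasByParts (hτ₁ : 0 ≤ τ₁) (hτ : τ₁ < τ₂) (hg : IsBackwardsRicciFlow g τ₁ τ₂)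
    (hγ : IsLGeodesic g γ τ₁ τ₂) (hU : SmoothFieldOn γ U τ₁ τ₂)
    (hV : PiecewiseSmoothFieldOn γ V τ₁ τ₂) : HasByParts g γ (Icc τ₁ τ₂) U V τ₁ τ₂ := by
  obtain ⟨n, t, h0, hn, ht⟩ := hV
  have hmono : ∀ j ≤ n, ∀ i ≤ j, t i ≤ t j := by
    intro j hj i hi
    induction j, hi using Nat.le_induction with
    | base => exact le_rfl
    | succ k hk ih => exact (ih (by omega)).trans (ht k (by omega)).1.le
  have key := chain_of_le (P := HasByParts g γ (Icc τ₁ τ₂) U V) (t := t) (n := n)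
    (by rwa [h0]) (fun i hi => (ht i hi).1.le)
    (fun i hi hlt => hasByParts_of_smooth hτ₁ hg hγ hU
      (h0 ▸ hmono i hi.le 0 (Nat.zero_le i)) hlt (hn ▸ hmono n le_rfl (i + 1) hi) (ht i hi).2)
    fun _ _ _ hb h h' => h.trans hb h'
  rw [h0, hn] at key
  exact key.2 hτ

end ByParts

end LGeom

end

theorem mainTheorem3 {E : Type*} [NormedAddCommGroup E] [NormedSpace ℝ E] [FiniteDimensional ℝ E]
    {M : Type*} [TopologicalSpace M] [T2Space M] [SecondCountableTopology M]
    [ChartedSpace E M] [IsManifold 𝓘(ℝ, E) ∞ M]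
    (τ₁ τ₂ : ℝ) (hτ₁ : 0 ≤ τ₁) (hτ : τ₁ < τ₂)
    (g : ℝ → LGeom.Metric E M) (hg : LGeom.IsBackwardsRicciFlow g τ₁ τ₂)
    (γ : ℝ → M) (hγ : LGeom.IsLGeodesic g γ τ₁ τ₂)
    (U V : ∀ τ, TangentSpace 𝓘(ℝ, E) (γ τ))
    (hU : LGeom.SmoothFieldOn γ U τ₁ τ₂) (hV : LGeom.PiecewiseSmoothFieldOn γ V τ₁ τ₂) :
    IntervalIntegrable (LGeom.indexIntegrand g γ (Icc τ₁ τ₂) U V) volume τ₁ τ₂ ∧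
    IntervalIntegrable (LGeom.jacobiIntegrand g γ (Icc τ₁ τ₂) U V) volume τ₁ τ₂ ∧
    (0 < τ₁ →
      LGeom.indexForm g γ τ₁ τ₂ U V =
        LGeom.boundaryTerm g γ (Icc τ₁ τ₂) U V τ₂ - LGeom.boundaryTerm g γ (Icc τ₁ τ₂) U V τ₁
          - 2 * ∫ τ in τ₁..τ₂, LGeom.jacobiIntegrand g γ (Icc τ₁ τ₂) U V τ) ∧
    (τ₁ = 0 →
      ∃ β₀ : ℝ, Tendsto (LGeom.boundaryTerm g γ (Icc τ₁ τ₂) U V) (𝓝[>] 0) (𝓝 β₀) ∧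
        LGeom.indexForm g γ τ₁ τ₂ U V =
          LGeom.boundaryTerm g γ (Icc τ₁ τ₂) U V τ₂ - β₀
            - 2 * ∫ τ in τ₁..τ₂, LGeom.jacobiIntegrand g γ (Icc τ₁ τ₂) U V τ) := by
  obtain ⟨hi, hj, β, hβ, hβ0, h⟩ := LGeom.hasByParts hτ₁ hτ hg hγ hU hV
  exact ⟨hi, hj, fun h0 => hβ h0 ▸ h, fun h0 => ⟨β, hβ0 h0, h⟩⟩
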